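/- Let $d\in\mathbb N$, $\alpha>-1/2$, $\mathbb R^{d+1}_+=\mathbb R^d\times(0,\infty)$, and write $x=(x',x_{d+1})$. Let $$d\mu_\alpha(x)=\frac{x_{d+1}^{2\alpha+1}}{(2\pi)^d\,2^{2\alpha}\,\Gamma(\alpha+1)^2}\,dx ,\qquad L^2_\alpha=L^2(\mathbb R^{d+1}_+,\mu_\alpha;\mathbb C),$$ $$j_\alpha(t)=\Gamma(\alpha+1)\sum_{k\ge 0}\frac{(-1)^k t^{2k}}{2^{2k}k!\,\Gamma(\alpha+k+1)},\qquad \Lambda(x,\xi)=e^{-i\langle x',\xi'\rangle}j_\alpha(x_{d+1}\xi_{d+1}).$$ The Weinstein transform $\mathcal F_W$ on $L^2_\alpha$ is the continuous linear extension of $\mathcal F_W f(\xi)=\int f(x)\Lambda(x,\xi)\,d\mu_\alpha(x)$ from $L^1_\alpha\cap L^2_\alpha$. A function $\varphi\in L^2_\alpha$ is a Weinstein wavelet if there is a constant $C_\varphi\in(0,\infty)$ with $\int_0^\infty|\mathcal F_W\varphi(a\xi)|^2\frac{da}{a}=C_\varphi$ for almost every $\xi\in\mathbb R^{d+1}_+$.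 A pair $(\varphi,\psi)$ of functions in $L^2_\alpha$ is a Weinstein two-wavelet with constant $C_{\varphi,\psi}\in\mathbb C$ if, for almost every $\xi\in\mathbb R^{d+1}_+$, the integral $\int_0^\infty\mathcal F_W\psi(a\xi)\,\overline{\mathcal F_W\varphi(a\xi)}\,\frac{da}{a}$ converges absolutely and equals $C_{\varphi,\psi}$. For $a>0$ and $x,y\in\mathbb R^{d+1}_+$ put $\varphi_a(x)=a^{-(2\alpha+d+2)}\varphi(x/a)$, $$\tau_x\varphi(y)=\frac{\Gamma(\alpha+1)}{\sqrt\pi\,\Gamma(\alpha+\frac12)}\int_0^\pi\varphi\Big(x'+y',\sqrt{x_{d+1}^2+y_{d+1}^2+2x_{d+1}y_{d+1}\cos\theta}\Big)(\sin\theta)^{2\alpha}\,d\theta,$$ $\varphi_{a,x}=a^{\alpha+1+d/2}\,\tau_x\varphi_a$, and for $f\in L^2_\alpha$ $$\Phi^W_\varphi(f)(a,x)=\int_{\mathbb R^{d+1}_+}f(y)\,\overline{\varphi_{a,x}(y)}\,d\mu_\alpha(y).$$ Let $\mathbb X=(0,\infty)\times\mathbb R^{d+1}_+$ carry the measure $\frac{d\mu_\alpha(x)\,da}{a^{2\alpha+d+3}}$,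 and let $L^2_\alpha(\mathbb X)$ be the corresponding $L^2$ space. Let $(\varphi,\psi)$ be a Weinstein two-wavelet with $C_{\varphi,\psi}=0$. Then the ranges $\Phi^W_\varphi(L^2_\alpha)$ and $\Phi^W_\psi(L^2_\alpha)$ are orthogonal in $L^2_\alpha(\mathbb X)$: for all $f,g\in L^2_\alpha$ such that $\Phi^W_\varphi(f)$ and $\Phi^W_\psi(g)$ belong to $L^2_\alpha(\mathbb X)$, $$\langle \Phi^W_\varphi(f),\Phi^W_\psi(g)\rangle_{L^2_\alpha(\mathbb X)}=0.$$ Moreover, if $\varphi$ (respectively $\psi$) is a Weinstein wavelet, then $\Phi^W_\varphi(f)$ (respectively $\Phi^W_\psi(f)$) belongs to $L^2_\alpha(\mathbb X)$ for every $f\in L^2_\alpha$; so if both are Weinstein wavelets, orthogonality holds for all $f,g\in L^2_\alpha$. -/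

import Mathlib

open MeasureTheory Set
open scoped ComplexConjugate

noncomputable section

namespace Weinstein

/-- The ambient space `ℝᵈ × ℝ` of points `x = (x', x_{d+1})`. The half space
`ℝ^{d+1}_+ = ℝᵈ × (0, ∞)` is singled out by the measure `measure d α` below, which does not charge
its complement. -/
abbrev Space (d : ℕ) : Type := EuclideanSpace ℝ (Fin d) × ℝ

/-- The measure `dμ_α(x) = x_{d+1}^{2α+1} / ((2π)^d 2^{2α} Γ(α+1)²) dx` on `ℝᵈ × (0, ∞)`. -/
def measure (d : ℕ) (α : ℝ) : Measure (Space d) :=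
  ((volume : Measure (Space d)).restrict {x | 0 < x.2}).withDensity fun x =>
    ENNReal.ofReal (x.2 ^ (2 * α + 1) /
      ((2 * Real.pi) ^ d * (2 : ℝ) ^ (2 * α) * Real.Gamma (α + 1) ^ 2))

/-- The space `L²_α(ℝ^{d+1}_+)` of complex-valued functions. -/
abbrev L2 (d : ℕ) (α : ℝ) : Type := Lp ℂ 2 (measure d α)

/-- The normalized Bessel function
`j_α(t) = Γ(α+1) ∑_k (-1)^k t^{2k} / (2^{2k} k! Γ(α+k+1))`. -/
def besselJ (α t : ℝ) : ℝ :=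
  Real.Gamma (α + 1) * ∑' k : ℕ,
    (-1 : ℝ) ^ k * t ^ (2 * k) / (2 ^ (2 * k) * (k.factorial : ℝ) * Real.Gamma (α + k + 1))

/-- The Weinstein kernel `Λ(x, ξ) = exp(-i⟨x', ξ'⟩) j_α(x_{d+1} ξ_{d+1})`. -/
def kernel {d : ℕ} (α : ℝ) (x ξ : Space d) : ℂ :=
  Complex.exp (-Complex.I * ((inner ℝ x.1 ξ.1 : ℝ) : ℂ)) * (besselJ α (x.2 * ξ.2) : ℂ)

/-- The Weinstein transform of an integrable function, given by its integral. -/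
def integralTransform {d : ℕ} (α : ℝ) (f : Space d → ℂ) (ξ : Space d) : ℂ :=
  ∫ x, f x * kernel α x ξ ∂(measure d α)

/-- `T` is a continuous linear extension to `L²_α` of the integral transform on `L¹_α ∩ L²_α`.
As `L¹_α ∩ L²_α` is dense in `L²_α`, there is at most one such `T`. -/
def IsTransformExtension {d : ℕ} {α : ℝ} (T : L2 d α →L[ℂ] L2 d α) : Prop :=
  ∀ (f : Space d → ℂ) (_ : MemLp f 1 (measure d α)) (h2 : MemLp f 2 (measure d α)),
    T (h2.toLp f) =ᵐ[measure d α] integralTransform α f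

open Classical in
/-- The Weinstein transform `F_W` on `L²_α`: the continuous linear extension of the integral
transform (it exists by the Plancherel theorem for `α > -1/2`; the value `0` is used only if there
is no extension). -/
def transform {d : ℕ} {α : ℝ} : L2 d α →L[ℂ] L2 d α :=
  if h : ∃ T : L2 d α →L[ℂ] L2 d α, IsTransformExtension T then h.choose else 0

/-- `φ` is a Weinstein wavelet with constant `C`: `0 < C < ∞`, and for almost every `ξ`,
`∫_0^∞ |F_W(φ)(aξ)|² da/a` converges and equals `C`. -/
def IsWavelet {d : ℕ} {α : ℝ} (φ : L2 d α) : Prop :=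
  ∃ C : ℝ, 0 < C ∧ ∀ᵐ ξ ∂(measure d α),
    IntegrableOn (fun a : ℝ => ‖transform φ (a • ξ)‖ ^ 2 / a) (Ioi 0) ∧
    ∫ a in Ioi (0 : ℝ), ‖transform φ (a • ξ)‖ ^ 2 / a = C

/-- `(φ, ψ)` is a Weinstein two-wavelet, and its two-wavelet constant `C_{φ,ψ}` is `C`: for almost
every `ξ`, the integral `∫_0^∞ F_W(ψ)(aξ) conj(F_W(φ)(aξ)) da/a` converges absolutely and
equals `C`. -/
def IsTwoWaveletWithConstant {d : ℕ} {α : ℝ} (φ ψ : L2 d α) (C : ℂ) : Prop :=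
  ∀ᵐ ξ ∂(measure d α),
    IntegrableOn (fun a : ℝ => transform ψ (a • ξ) * conj (transform φ (a • ξ)) / (a : ℂ))
      (Ioi 0) ∧
    ∫ a in Ioi (0 : ℝ), transform ψ (a • ξ) * conj (transform φ (a • ξ)) / (a : ℂ) = C

/-- The dilation `φ_a(x) = a^{-(2α+d+2)} φ(x/a)`. -/
def dilation {d : ℕ} (α a : ℝ) (φ : Space d → ℂ) (x : Space d) : ℂ :=
  ((a ^ (-(2 * α + d + 2)) : ℝ) : ℂ) * φ (a⁻¹ • x)

/-- The generalized translation
`τ_x φ(y) = C_α ∫_0^π φ(x'+y', √(x_{d+1}² + y_{d+1}² + 2 x_{d+1} y_{d+1} cos θ)) (sin θ)^{2α} dθ`,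
with `C_α = Γ(α+1) / (√π Γ(α+1/2))`. For `φ` in `L²_α` and `x` in the half space the integral
converges absolutely for almost every `y`. -/
def translation {d : ℕ} (α : ℝ) (x : Space d) (φ : Space d → ℂ) (y : Space d) : ℂ :=
  ((Real.Gamma (α + 1) / (Real.sqrt Real.pi * Real.Gamma (α + 1 / 2)) : ℝ) : ℂ) *
    ∫ θ in Ioo 0 Real.pi,
      φ (x.1 + y.1, Real.sqrt (x.2 ^ 2 + y.2 ^ 2 + 2 * x.2 * y.2 * Real.cos θ)) *
        ((Real.sin θ ^ (2 * α) : ℝ) : ℂ)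

/-- The wavelet family `φ_{a,x}(y) = a^{α+1+d/2} τ_x φ_a (y)`. -/
def waveletFamily {d : ℕ} (α : ℝ) (φ : Space d → ℂ) (a : ℝ) (x y : Space d) : ℂ :=
  ((a ^ (α + 1 + (d : ℝ) / 2) : ℝ) : ℂ) * translation α x (dilation α a φ) y

/-- The Weinstein continuous wavelet transform
`Φ_φ(f)(a, x) = ∫ f(y) conj(φ_{a,x}(y)) dμ_α(y)`. -/
def waveletTransform {d : ℕ} (α : ℝ) (φ f : Space d → ℂ) (p : ℝ × Space d) : ℂ :=
  ∫ y, f y * conj (waveletFamily α φ p.1 p.2 y) ∂(measure d α)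

/-- The measure `dμ_α(a, x) = dμ_α(x) da / a^{2α+d+3}` on `𝕏 = (0, ∞) × ℝ^{d+1}_+`. -/
def measureX (d : ℕ) (α : ℝ) : Measure (ℝ × Space d) :=
  (((volume : Measure ℝ).restrict (Ioi 0)).withDensity fun a =>
    ENNReal.ofReal (a ^ (-(2 * α + d + 3)))).prod (measure d α)

/-- The range `Φ_φ(L²_α)`, as a set of elements of `L²_α(𝕏)`: the classes of those functions
`Φ_φ(f)`, `f ∈ L²_α`, that are square integrable on `𝕏`. -/
def waveletRange {d : ℕ} {α : ℝ} (φ : L2 d α) : Set (Lp ℂ 2 (measureX d α)) :=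
  {F | ∃ f : L2 d α, F =ᵐ[measureX d α] waveletTransform α φ f}

end Weinstein

end

open MeasureTheory Set
open scoped ComplexConjugate

noncomputable section

namespace Weinstein

/-! Write F for the Weinstein transform. The proof rests on a spectral formula,
`waveletTransform_eq`: at a fixed scale a, the function Φ_φ(f)(a, ·) is a constant times a^{α+1+d/2}
times the Weinstein transform of the symbol ξ ↦ F f(ξ) conj(F φ(aξ)). Plancherel in x turns the
pairing of two wavelet transforms at scale a into the pairing of their symbols, and the resulting
factor a^{2α+d+2} reduces the weight a^{-(2α+d+3)} to da/a. After Fubini, the integral over a is the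
conjugate of the two-wavelet integral, hence 0. Fubini is legitimate because Φ_φ(f) is square
integrable on 𝕏 exactly when its symbol is square integrable for da/a ⊗ μ_α
(`memLp_waveletTransform_iff`). If φ is a wavelet, integrating the squared symbol in a first gives C
|F f(ξ)|², which is integrable.

Plancherel and the spectral formula are both derived from the Gaussians exp(-s|x|²/2 + ∑ z_i x_i),
with s > 0 and complex z acting on x' only. This family is stable under products, conjugation,
dilation and, up to scalars, under F. It spans a dense subspace of L²_α, and it determines measures
on the half space (`measure_ext_of_integral_gauss`). Its integrals against Bessel functions are
explicit, since termwise integration of the Bessel series yields an exponential series. The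
θ-integral of a translated Gaussian is again a Bessel function, by Poisson's formula
(`integral_exp_mul_cos`). So the norm identity for F, the invariance of μ_α under generalized
translation, its scaling and the spectral formula all reduce to identities between explicit
exponentials, then extend by density or uniqueness.

With the given normalization of μ_α, F is K times a unitary operator, where K = `gaussConst`
simplifies to 1/((2π)^{d/2} 2^α Γ(α+1)). -/

open Filter Topology

/-! ### Bessel coefficients and the entire Bessel series. -/

/-- The coefficients of the power series `j_α(t) = ∑ b_k (-t²)^k`. -/
def besselCoeff (α : ℝ) (k : ℕ) : ℝ :=
  Real.Gamma (α + 1) / (4 ^ k * (k.factorial : ℝ) * Real.Gamma (α + k + 1))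

/-- The entire function `z ↦ ∑ b_k z^k`, so that `j_α(t)` is its value at `-t²`. -/
def besselSeries (α : ℝ) (z : ℂ) : ℂ := ∑' k : ℕ, (besselCoeff α k : ℂ) * z ^ k

lemma besselCoeff_zero {α : ℝ} (hα : -1 / 2 < α) : besselCoeff α 0 = 1 := by
  have : Real.Gamma (α + 1) ≠ 0 := (Real.Gamma_pos_of_pos (by linarith)).ne'
  simp [besselCoeff, this]

lemma besselCoeff_pos {α : ℝ} (hα : -1 / 2 < α) (k : ℕ) : 0 < besselCoeff α k := by
  have h1 : 0 < Real.Gamma (α + 1) := Real.Gamma_pos_of_pos (by linarith)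
  have h2 : 0 < Real.Gamma (α + k + 1) :=
    Real.Gamma_pos_of_pos (by have : (0 : ℝ) ≤ k := k.cast_nonneg; linarith)
  unfold besselCoeff
  positivity

lemma besselCoeff_succ {α : ℝ} (hα : -1 / 2 < α) (k : ℕ) :
    besselCoeff α (k + 1) = besselCoeff α k / (4 * (k + 1) * (α + k + 1)) := by
  have hk : (0 : ℝ) ≤ k := k.cast_nonneg
  have h0 : α + k + 1 ≠ 0 := by linarith
  have h2 : Real.Gamma (α + k + 1) ≠ 0 := (Real.Gamma_pos_of_pos (by linarith)).ne'
  have h3 : Real.Gamma (α + (k + 1 : ℕ) + 1) = (α + k + 1) * Real.Gamma (α + k + 1) := by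
    rw [← Real.Gamma_add_one h0]; push_cast; ring_nf
  unfold besselCoeff
  rw [h3, Nat.factorial_succ]
  push_cast
  rw [pow_succ]
  field_simp

/-- As α > -1/2 gives 4(α+k+1) ≥ 1, each step of the recursion gains at least a factor 1/(k+1). The
series is therefore dominated by the exponential series. -/
lemma besselCoeff_le {α : ℝ} (hα : -1 / 2 < α) (k : ℕ) :
    besselCoeff α k ≤ 1 / (k.factorial : ℝ) := by
  induction k with
  | zero => simp [besselCoeff_zero hα]
  | succ k ih =>
    have hk : (0 : ℝ) ≤ k := k.cast_nonneg
    rw [besselCoeff_succ hα, Nat.factorial_succ]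
    push_cast
    have h1 : (k + 1 : ℝ) ≤ 4 * (k + 1) * (α + k + 1) := by nlinarith
    calc _ ≤ 1 / (k.factorial : ℝ) / (k + 1 : ℝ) := by
          gcongr
      _ = _ := by field_simp

lemma summable_besselCoeff_mul_pow {α : ℝ} (hα : -1 / 2 < α) (r : ℝ) (hr : 0 ≤ r) :
    Summable fun k => besselCoeff α k * r ^ k := by
  refine Summable.of_nonneg_of_le (fun k => mul_nonneg (besselCoeff_pos hα k).le (by positivity))
    (fun k => ?_) (Real.summable_pow_div_factorial r)
  calc _ ≤ 1 / (k.factorial : ℝ) * r ^ k := by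
        gcongr; exact besselCoeff_le hα k
    _ = _ := by ring

lemma hasSum_besselSeries {α : ℝ} (hα : -1 / 2 < α) (z : ℂ) :
    HasSum (fun k => (besselCoeff α k : ℂ) * z ^ k) (besselSeries α z) := by
  refine Summable.hasSum (Summable.of_norm ?_)
  refine (summable_besselCoeff_mul_pow hα ‖z‖ (norm_nonneg _)).congr fun k => ?_
  rw [norm_mul, norm_pow, Complex.norm_real, Real.norm_of_nonneg (besselCoeff_pos hα k).le]

lemma continuous_besselSeries {α : ℝ} (hα : -1 / 2 < α) : Continuous (besselSeries α) := by
  rw [continuous_iff_continuousAt]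
  intro z
  have : ContinuousOn (besselSeries α) (Metric.ball 0 (‖z‖ + 1)) := by
    refine continuousOn_tsum (u := fun k => besselCoeff α k * (‖z‖ + 1) ^ k)
      (fun k => by fun_prop) (summable_besselCoeff_mul_pow hα _ (by positivity)) ?_
    intro k w hw
    rw [norm_mul, norm_pow, Complex.norm_real, Real.norm_of_nonneg (besselCoeff_pos hα k).le]
    have := (besselCoeff_pos hα k).le
    rw [mem_ball_zero_iff] at hw
    gcongr
  exact this.continuousAt (Metric.isOpen_ball.mem_nhds (by simp))

/-- Passing to an entire function of t² treats j_α (negative argument) and its modified counterpart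
(positive argument) together. The first comes from the kernel, the second from translated Gaussians.
-/
lemma besselJ_eq (α t : ℝ) : (besselJ α t : ℂ) = besselSeries α (-(t : ℂ) ^ 2) := by
  unfold besselJ besselSeries
  rw [← tsum_mul_left, Complex.ofReal_tsum]
  refine tsum_congr fun k => ?_
  have h4 : (2 : ℂ) ^ (2 * k) = 4 ^ k := by rw [pow_mul]; norm_num
  have hm : (-(t : ℂ) ^ 2) ^ k = (-1) ^ k * (t : ℂ) ^ (2 * k) := by
    rw [neg_pow, ← pow_mul]
  rw [hm]
  unfold besselCoeff
  push_cast
  rw [h4]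
  ring

lemma continuous_besselJ {α : ℝ} (hα : -1 / 2 < α) : Continuous (besselJ α) := by
  have h : Continuous fun t : ℝ => (besselJ α t : ℂ) := by
    simp_rw [besselJ_eq]
    exact (continuous_besselSeries hα).comp (by fun_prop)
  exact (Complex.continuous_re.comp h).congr fun t => Complex.ofReal_re _

/-! ### The angular measure and the Poisson representation. -/

/-- The measure `(sin θ)^{2α} dθ` on `(0, π)`. -/
def sinMeasure (α : ℝ) : Measure ℝ :=
  (volume.restrict (Ioo 0 Real.pi)).withDensity fun θ => ENNReal.ofReal (Real.sin θ ^ (2 * α))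

lemma measurable_sin_rpow (α : ℝ) : Measurable fun θ => Real.sin θ ^ (2 * α) := by fun_prop

/-- For α ≥ 0 the function is at most 1. For α < 0 the exponent lies in (-1, 0), and Jordan's
inequality sin x ≥ 2x/π on [0, π/2] compares it with a power of the distance to the nearer endpoint.
-/
lemma integrableOn_sin_rpow {α : ℝ} (hα : -1 / 2 < α) :
    IntegrableOn (fun θ => Real.sin θ ^ (2 * α)) (Ioo 0 Real.pi) := by
  have hpi := Real.pi_pos
  have i1 : IntervalIntegrable (fun θ : ℝ => θ ^ (2 * α)) volume 0 Real.pi :=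
    intervalIntegral.intervalIntegrable_rpow' (by linarith)
  have i2 : IntervalIntegrable (fun θ : ℝ => (Real.pi - θ) ^ (2 * α)) volume 0 Real.pi := by
    simpa using (i1.comp_sub_left Real.pi).symm
  have j1 := (intervalIntegrable_iff_integrableOn_Ioo_of_le hpi.le).1 i1
  have j2 := (intervalIntegrable_iff_integrableOn_Ioo_of_le hpi.le).1 i2
  have j0 : IntegrableOn (fun _ : ℝ => (1 : ℝ)) (Ioo 0 Real.pi) := by simp
  refine Integrable.mono' (j0.add ((j1.add j2).const_mul ((2 / Real.pi) ^ (2 * α))))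
    (measurable_sin_rpow α).aestronglyMeasurable ?_
  filter_upwards [ae_restrict_mem measurableSet_Ioo] with θ hθ
  have hs : 0 < Real.sin θ := Real.sin_pos_of_mem_Ioo hθ
  rw [Real.norm_of_nonneg (by positivity)]
  have hθ1 := hθ.1
  have hθ2 : 0 < Real.pi - θ := sub_pos.2 hθ.2
  simp only [Pi.add_apply]
  rcases le_total 0 α with h | h
  · have : Real.sin θ ^ (2 * α) ≤ 1 := Real.rpow_le_one hs.le (Real.sin_le_one θ) (by linarith)
    have : 0 ≤ (2 / Real.pi) ^ (2 * α) * (θ ^ (2 * α) + (Real.pi - θ) ^ (2 * α)) := by positivity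
    linarith
  · have key : ∀ x, 0 < x → x ≤ Real.pi / 2 →
        Real.sin x ^ (2 * α) ≤ (2 / Real.pi) ^ (2 * α) * x ^ (2 * α) := by
      intro x hx hx'
      rw [← Real.mul_rpow (by positivity) hx.le]
      exact Real.rpow_le_rpow_of_nonpos (by positivity) (Real.mul_le_sin hx.le hx') (by linarith)
    have p1 : 0 ≤ (2 / Real.pi) ^ (2 * α) * θ ^ (2 * α) := by positivity
    have p2 : 0 ≤ (2 / Real.pi) ^ (2 * α) * (Real.pi - θ) ^ (2 * α) := by positivity
    rcases le_total θ (Real.pi / 2) with h' | h'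
    · have := key θ hθ1 h'
      linarith
    · have := key (Real.pi - θ) hθ2 (by linarith)
      rw [Real.sin_pi_sub] at this
      linarith

lemma isFiniteMeasure_sinMeasure {α : ℝ} (hα : -1 / 2 < α) : IsFiniteMeasure (sinMeasure α) :=
  isFiniteMeasure_withDensity_ofReal (integrableOn_sin_rpow hα).2

lemma integral_sinMeasure {E : Type*} [NormedAddCommGroup E] [NormedSpace ℝ E] (α : ℝ)
    (f : ℝ → E) :
    ∫ θ, f θ ∂(sinMeasure α) = ∫ θ in Ioo 0 Real.pi, Real.sin θ ^ (2 * α) • f θ := by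
  unfold sinMeasure
  rw [integral_withDensity_eq_integral_toReal_smul (by fun_prop) (by simp)]
  refine setIntegral_congr_fun measurableSet_Ioo fun θ hθ => ?_
  have hs : 0 < Real.sin θ := Real.sin_pos_of_mem_Ioo hθ
  rw [ENNReal.toReal_ofReal (by positivity)]

lemma integrable_sinMeasure {α : ℝ} (hα : -1 / 2 < α) {E : Type*} [NormedAddCommGroup E]
    {f : ℝ → E} (hf : Continuous f) : Integrable f (sinMeasure α) := by
  have := isFiniteMeasure_sinMeasure hα
  obtain ⟨C, hC⟩ := (isCompact_Icc (a := (0 : ℝ)) (b := Real.pi)).exists_bound_of_continuousOn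
    hf.continuousOn
  refine Integrable.of_bound hf.aestronglyMeasurable C ?_
  refine (withDensity_absolutelyContinuous _ _).ae_le ?_
  filter_upwards [ae_restrict_mem measurableSet_Ioo] with θ hθ
  exact hC θ (Ioo_subset_Icc_self hθ)

/-- The total mass of `sinMeasure α`. -/
def sinMass (α : ℝ) : ℝ := ∫ _θ, (1 : ℝ) ∂(sinMeasure α)

lemma sinMass_pos {α : ℝ} (hα : -1 / 2 < α) : 0 < sinMass α := by
  unfold sinMass
  rw [integral_sinMeasure]
  simp only [smul_eq_mul, mul_one]
  rw [setIntegral_pos_iff_support_of_nonneg_ae _ (integrableOn_sin_rpow hα)]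
  · refine lt_of_lt_of_le (b := volume (Ioo 0 Real.pi)) (by simp [Real.pi_pos]) (measure_mono ?_)
    intro θ hθ
    exact ⟨(Real.rpow_pos_of_pos (Real.sin_pos_of_mem_Ioo hθ) _).ne', hθ⟩
  · filter_upwards [ae_restrict_mem measurableSet_Ioo] with θ hθ
    exact (Real.rpow_pos_of_pos (Real.sin_pos_of_mem_Ioo hθ) _).le

/-- Against sin^{2α}, the integrand is the derivative of cos^k sin^{2α+1}, which vanishes at 0 and π
because 2α+1 > 0. The truncated exponent k - 1 is harmless at k = 0, where its coefficient is 0. -/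
lemma integral_deriv_cos_pow {α : ℝ} (hα : -1 / 2 < α) (k : ℕ) :
    ∫ θ, ((2 * α + 1) * Real.cos θ ^ (k + 1) - k * Real.cos θ ^ (k - 1) * Real.sin θ ^ 2)
      ∂(sinMeasure α) = 0 := by
  have hpi := Real.pi_pos
  rw [integral_sinMeasure, ← integral_Ioc_eq_integral_Ioo, ← intervalIntegral.integral_of_le hpi.le]
  rw [intervalIntegral.integral_eq_sub_of_hasDerivAt_of_le hpi.le
    (f := fun θ => Real.cos θ ^ k * Real.sin θ ^ (2 * α + 1))]
  · simp [Real.zero_rpow (by linarith : 2 * α + 1 ≠ 0)]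
  · refine ContinuousOn.mul (by fun_prop) ?_
    exact Real.continuous_sin.continuousOn.rpow_const fun x _ => Or.inr (by linarith)
  · intro θ hθ
    have hs : 0 < Real.sin θ := Real.sin_pos_of_mem_Ioo hθ
    have h1 := ((Real.hasDerivAt_cos θ).pow k).mul
      ((Real.hasDerivAt_sin θ).rpow_const (p := 2 * α + 1) (Or.inl hs.ne'))
    refine h1.congr_deriv ?_
    have e1 : (2 * α + 1 - 1) = 2 * α := by ring
    have e2 : Real.sin θ ^ (2 * α + 1) = Real.sin θ ^ (2 * α) * Real.sin θ := by
      rw [Real.rpow_add hs, Real.rpow_one]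
    simp only [Pi.pow_apply]
    rw [e1, e2, smul_eq_mul]
    ring
  · rw [intervalIntegrable_iff_integrableOn_Ioo_of_le hpi.le]
    have := integrable_sinMeasure hα (f := fun θ => ((2 * α + 1) * Real.cos θ ^ (k + 1) -
      k * Real.cos θ ^ (k - 1) * Real.sin θ ^ 2)) (by fun_prop)
    unfold sinMeasure at this
    rw [integrable_withDensity_iff_integrable_smul' (by fun_prop) (by simp)] at this
    refine this.congr ?_
    filter_upwards [ae_restrict_mem measurableSet_Ioo] with θ hθ
    have hs : 0 < Real.sin θ := Real.sin_pos_of_mem_Ioo hθ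
    rw [ENNReal.toReal_ofReal (by positivity)]

lemma integral_cos_sinMeasure {α : ℝ} (hα : -1 / 2 < α) :
    ∫ θ, Real.cos θ ^ 1 ∂(sinMeasure α) = 0 := by
  have h := integral_deriv_cos_pow hα 0
  simp only [Nat.cast_zero, zero_mul, sub_zero, zero_add] at h
  rw [integral_const_mul] at h
  exact (mul_eq_zero.1 h).resolve_left (by linarith)

/-- Replacing sin² by 1 - cos² in the previous identity gives a two-step recursion for the moments
of cos. It annihilates the odd moments and matches the recursion of `besselCoeff` on the even ones.
-/
lemma integral_cos_pow_add_two {α : ℝ} (hα : -1 / 2 < α) (k : ℕ) :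
    (k + 2 * α + 2) * ∫ θ, Real.cos θ ^ (k + 2) ∂(sinMeasure α) =
      (k + 1) * ∫ θ, Real.cos θ ^ k ∂(sinMeasure α) := by
  have h := integral_deriv_cos_pow hα (k + 1)
  have e : ∀ θ, ((2 * α + 1) * Real.cos θ ^ (k + 1 + 1) -
      ((k + 1 : ℕ) : ℝ) * Real.cos θ ^ (k + 1 - 1) * Real.sin θ ^ 2) =
      (k + 2 * α + 2) * Real.cos θ ^ (k + 2) - (k + 1) * Real.cos θ ^ k := by
    intro θ
    rw [Real.sin_sq]
    simp only [Nat.add_sub_cancel]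
    push_cast
    ring
  simp_rw [e] at h
  rw [integral_sub ((integrable_sinMeasure hα (by fun_prop)).const_mul _)
    ((integrable_sinMeasure hα (by fun_prop)).const_mul _), integral_const_mul,
    integral_const_mul] at h
  linarith

lemma integral_cos_pow_odd {α : ℝ} (hα : -1 / 2 < α) (k : ℕ) :
    ∫ θ, Real.cos θ ^ (2 * k + 1) ∂(sinMeasure α) = 0 := by
  induction k with
  | zero => exact integral_cos_sinMeasure hα
  | succ k ih =>
    have h := integral_cos_pow_add_two hα (2 * k + 1)
    rw [ih, mul_zero] at h
    have hk : (0 : ℝ) ≤ k := k.cast_nonneg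
    exact (mul_eq_zero.1 h).resolve_left (by push_cast; linarith)

lemma integral_cos_pow_even {α : ℝ} (hα : -1 / 2 < α) (k : ℕ) :
    ∫ θ, Real.cos θ ^ (2 * k) ∂(sinMeasure α) =
      sinMass α * besselCoeff α k * ((2 * k).factorial : ℝ) := by
  induction k with
  | zero => simp [sinMass, besselCoeff_zero hα]
  | succ k ih =>
    have h := integral_cos_pow_add_two hα (2 * k)
    have hk : (0 : ℝ) ≤ k := k.cast_nonneg
    have h0 : ((2 * k : ℕ) : ℝ) + 2 * α + 2 ≠ 0 := by push_cast; linarith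
    rw [← mul_right_inj' h0, show 2 * (k + 1) = 2 * k + 2 by ring, h, ih, besselCoeff_succ hα,
      Nat.factorial_succ, Nat.factorial_succ]
    have h1 : (α + k + 1) ≠ 0 := by linarith
    push_cast
    field_simp
    ring

/-- The Poisson representation of the Bessel function. -/
lemma integral_exp_mul_cos {α : ℝ} (hα : -1 / 2 < α) (u : ℂ) :
    ∫ θ, Complex.exp (u * Real.cos θ) ∂(sinMeasure α) = sinMass α * besselSeries α (u ^ 2) := by
  have hfin := isFiniteMeasure_sinMeasure hα
  have hS := hasSum_integral_of_summable_integral_norm (μ := sinMeasure α)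
    (F := fun (n : ℕ) (θ : ℝ) => (u * Real.cos θ) ^ n / (n.factorial : ℂ))
    (fun n => integrable_sinMeasure hα (by fun_prop)) (by
      refine Summable.of_nonneg_of_le (fun n => integral_nonneg fun θ => norm_nonneg _) (fun n => ?_)
        ((Real.summable_pow_div_factorial ‖u‖).mul_right (sinMass α))
      unfold sinMass
      rw [← integral_const_mul]
      refine integral_mono (integrable_sinMeasure hα (by fun_prop))
        (integrable_sinMeasure hα (by fun_prop)) fun θ => ?_
      simp only [norm_div, norm_pow, norm_mul, Complex.norm_real, Complex.norm_natCast, mul_one]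
      gcongr
      exact mul_le_of_le_one_right (norm_nonneg _) (Real.abs_cos_le_one θ))
  have e1 : ∀ θ : ℝ, ∑' n : ℕ, (u * Real.cos θ) ^ n / (n.factorial : ℂ) =
      Complex.exp (u * Real.cos θ) := fun θ => by
    rw [Complex.exp_eq_exp_ℂ, NormedSpace.exp_eq_tsum_div]
  simp_rw [e1] at hS
  have e2 : ∀ n : ℕ, ∫ θ, (u * Real.cos θ) ^ n / (n.factorial : ℂ) ∂(sinMeasure α) =
      u ^ n / (n.factorial : ℂ) * ((∫ θ, Real.cos θ ^ n ∂(sinMeasure α) : ℝ) : ℂ) := fun n => by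
    rw [← integral_complex_ofReal, ← integral_const_mul]
    congr 1
    ext θ
    push_cast
    ring
  simp_rw [e2] at hS
  -- The odd moments vanish, so the sum over n reduces to a sum over n = 2k, in which (2k)! cancels.
  have hinj : Function.Injective fun k : ℕ => 2 * k := fun a b h => by simpa using h
  rw [← hinj.hasSum_iff] at hS
  · refine hS.unique ?_
    refine ((hasSum_besselSeries hα (u ^ 2)).mul_left (sinMass α : ℂ)).congr_fun fun k => ?_
    simp only [Function.comp]
    rw [integral_cos_pow_even hα]
    have : ((2 * k).factorial : ℂ) ≠ 0 := by exact_mod_cast (2 * k).factorial_ne_zero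
    push_cast
    rw [pow_mul]
    field_simp
  · intro n hn
    rcases Nat.even_or_odd' n with ⟨k, rfl | rfl⟩
    · exact absurd ⟨k, rfl⟩ hn
    · rw [integral_cos_pow_odd hα]
      simp

/-- By Poisson's formula with u = it, j_α(t) is an average of numbers of modulus 1. -/
lemma norm_besselJ_le {α : ℝ} (hα : -1 / 2 < α) (t : ℝ) : ‖(besselJ α t : ℂ)‖ ≤ 1 := by
  have hfin := isFiniteMeasure_sinMeasure hα
  have h := integral_exp_mul_cos hα (t * Complex.I)
  rw [mul_pow, Complex.I_sq, mul_neg_one, ← besselJ_eq] at h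
  have hm := sinMass_pos hα
  have h2 : ‖∫ θ, Complex.exp (t * Complex.I * Real.cos θ) ∂(sinMeasure α)‖ ≤ sinMass α := by
    refine (norm_integral_le_integral_norm _).trans_eq ?_
    unfold sinMass
    congr 1
    ext θ
    rw [show (t : ℂ) * Complex.I * Real.cos θ = ((t * Real.cos θ : ℝ) : ℂ) * Complex.I by
      push_cast; ring, Complex.norm_exp_ofReal_mul_I]
  rw [h, norm_mul, Complex.norm_real, Real.norm_of_nonneg hm.le] at h2
  exact le_of_mul_le_mul_left (by simpa using h2) hm

/-! ### Radial Gaussian integrals against Bessel functions. -/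

/-- The moments of the Gaussian with respect to `r^{2α+1} dr`. -/
lemma integral_rpow_mul_gaussian_mul_pow {α : ℝ} (hα : -1 / 2 < α) {s : ℝ} (hs : 0 < s) (k : ℕ) :
    IntegrableOn (fun r : ℝ => r ^ (2 * α + 1) * Real.exp (-(s / 2) * r ^ 2) * (r ^ 2) ^ k)
      (Ioi 0) ∧
    besselCoeff α k *
      ∫ r in Ioi (0 : ℝ), r ^ (2 * α + 1) * Real.exp (-(s / 2) * r ^ 2) * (r ^ 2) ^ k =
      (s / 2) ^ (-(α + 1)) / 2 * Real.Gamma (α + 1) * ((1 / (2 * s)) ^ k / k.factorial) := by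
  have hk : (0 : ℝ) ≤ k := k.cast_nonneg
  have e : ∀ r ∈ Ioi (0 : ℝ), r ^ (2 * α + 1 + 2 * k) * Real.exp (-(s / 2) * r ^ (2 : ℝ)) =
      r ^ (2 * α + 1) * Real.exp (-(s / 2) * r ^ 2) * (r ^ 2) ^ k := by
    intro r hr
    have hr : 0 < r := hr
    rw [Real.rpow_add hr, Real.rpow_two, ← pow_mul,
      show (2 * k : ℝ) = ((2 * k : ℕ) : ℝ) by push_cast; ring, Real.rpow_natCast]
    ring
  constructor
  · refine (integrableOn_rpow_mul_exp_neg_mul_rpow (p := 2) (s := 2 * α + 1 + 2 * k) (b := s / 2)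
      (by linarith) (by norm_num) (by positivity)).congr_fun e measurableSet_Ioi
  · rw [← setIntegral_congr_fun measurableSet_Ioi e,
      integral_rpow_mul_exp_neg_mul_rpow (by norm_num) (by linarith) (by positivity)]
    -- The moment contains the factor Γ(α+k+1), which cancels the one in the denominator of
    -- `besselCoeff`. Only 1/k! survives, so the sum over k becomes an exponential.
    have h2 : Real.Gamma (α + k + 1) ≠ 0 := (Real.Gamma_pos_of_pos (by linarith)).ne'
    have e1 : (2 * α + 1 + 2 * k + 1) / 2 = α + k + 1 := by ring
    have e2 : -(2 * α + 1 + 2 * k + 1) / 2 = -(α + 1) + -(k : ℝ) := by ring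
    rw [e1, e2, Real.rpow_add (by positivity), Real.rpow_neg (by positivity) (k : ℝ),
      Real.rpow_natCast]
    unfold besselCoeff
    have h4 : (2 * s) ^ k = 4 ^ k * (s / 2) ^ k := by rw [← mul_pow]; ring_nf
    rw [div_pow 1, one_pow, h4]
    field_simp

lemma hasSum_rpow_mul_gaussian {α : ℝ} (hα : -1 / 2 < α) (s r : ℝ) (a : ℂ) :
    HasSum (fun k => (besselCoeff α k : ℂ) * a ^ k *
        ((r ^ (2 * α + 1) * Real.exp (-(s / 2) * r ^ 2) * (r ^ 2) ^ k : ℝ) : ℂ))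
      (((r ^ (2 * α + 1) * Real.exp (-(s / 2) * r ^ 2) : ℝ) : ℂ) *
        besselSeries α (a * (r : ℂ) ^ 2)) := by
  refine ((hasSum_besselSeries hα (a * (r : ℂ) ^ 2)).mul_left _).congr_fun fun k => ?_
  push_cast
  rw [mul_pow]
  ring

lemma summable_integral_norm_gaussian {α : ℝ} (hα : -1 / 2 < α) {s : ℝ} (hs : 0 < s) (a : ℂ) :
    Summable fun k => ∫ r in Ioi (0 : ℝ), ‖(besselCoeff α k : ℂ) * a ^ k *
      ((r ^ (2 * α + 1) * Real.exp (-(s / 2) * r ^ 2) * (r ^ 2) ^ k : ℝ) : ℂ)‖ := by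
  have e : ∀ k, ∫ r in Ioi (0 : ℝ), ‖(besselCoeff α k : ℂ) * a ^ k *
      ((r ^ (2 * α + 1) * Real.exp (-(s / 2) * r ^ 2) * (r ^ 2) ^ k : ℝ) : ℂ)‖ =
      (s / 2) ^ (-(α + 1)) / 2 * Real.Gamma (α + 1) * ((‖a‖ / (2 * s)) ^ k / k.factorial) := by
    intro k
    have h := (integral_rpow_mul_gaussian_mul_pow hα hs k).2
    have e1 : ∫ r in Ioi (0 : ℝ), ‖(besselCoeff α k : ℂ) * a ^ k *
      ((r ^ (2 * α + 1) * Real.exp (-(s / 2) * r ^ 2) * (r ^ 2) ^ k : ℝ) : ℂ)‖ =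
      ‖a‖ ^ k * (besselCoeff α k *
      ∫ r in Ioi (0 : ℝ), r ^ (2 * α + 1) * Real.exp (-(s / 2) * r ^ 2) * (r ^ 2) ^ k) := by
      rw [← integral_const_mul, ← integral_const_mul]
      refine setIntegral_congr_fun measurableSet_Ioi fun r hr => ?_
      have hr : 0 < r := hr
      rw [norm_mul, norm_mul, norm_pow, Complex.norm_real, Complex.norm_real,
        Real.norm_of_nonneg (besselCoeff_pos hα k).le, Real.norm_of_nonneg (by positivity)]
      ring
    rw [e1, h, div_pow, div_pow]
    ring
  simp_rw [e]
  exact (Real.summable_pow_div_factorial _).mul_left _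

/-- The integral of a Gaussian against the Bessel function of either kind. -/
lemma integral_gaussian_mul_besselSeries {α : ℝ} (hα : -1 / 2 < α) {s : ℝ} (hs : 0 < s) (a : ℂ) :
    ∫ r in Ioi (0 : ℝ), ((r ^ (2 * α + 1) * Real.exp (-(s / 2) * r ^ 2) : ℝ) : ℂ) *
        besselSeries α (a * (r : ℂ) ^ 2) =
      ((s / 2) ^ (-(α + 1)) / 2 * Real.Gamma (α + 1) : ℝ) * Complex.exp (a / (2 * s)) := by
  have hS := hasSum_integral_of_summable_integral_norm
    (μ := (volume : Measure ℝ).restrict (Ioi 0))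
    (F := fun (k : ℕ) (r : ℝ) => (besselCoeff α k : ℂ) * a ^ k *
      ((r ^ (2 * α + 1) * Real.exp (-(s / 2) * r ^ 2) * (r ^ 2) ^ k : ℝ) : ℂ))
    (fun k => ((integral_rpow_mul_gaussian_mul_pow hα hs k).1.ofReal (𝕜 := ℂ)).const_mul
      ((besselCoeff α k : ℂ) * a ^ k)) (summable_integral_norm_gaussian hα hs a)
  simp_rw [fun r => (hasSum_rpow_mul_gaussian hα s r a).tsum_eq] at hS
  refine hS.unique ?_
  have hE : HasSum (fun k : ℕ => (a / (2 * s)) ^ k / (k.factorial : ℂ))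
      (Complex.exp (a / (2 * s))) := by
    rw [Complex.exp_eq_exp_ℂ]
    exact NormedSpace.expSeries_div_hasSum_exp _
  refine (hE.mul_left _).congr_fun fun k => ?_
  have h := (integral_rpow_mul_gaussian_mul_pow hα hs k).2
  rw [integral_const_mul, integral_complex_ofReal]
  have h' := congrArg Complex.ofReal h
  rw [Complex.ofReal_mul] at h'
  rw [mul_right_comm, h']
  push_cast
  rw [div_pow, div_pow]
  ring

/-! ### The measure μ_α and the modulated Gaussians. -/

variable {d : ℕ} {α : ℝ}

/-- The radial factor of `measure d α`. -/
def radialMeasure (d : ℕ) (α : ℝ) : Measure ℝ :=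
  ((volume : Measure ℝ).restrict (Ioi 0)).withDensity fun r =>
    ENNReal.ofReal (r ^ (2 * α + 1) /
      ((2 * Real.pi) ^ d * (2 : ℝ) ^ (2 * α) * Real.Gamma (α + 1) ^ 2))

instance : SigmaFinite (radialMeasure d α) := by
  unfold radialMeasure
  exact SigmaFinite.withDensity_ofReal _

lemma measure_eq_prod (d : ℕ) (α : ℝ) :
    measure d α = (volume : Measure (EuclideanSpace ℝ (Fin d))).prod (radialMeasure d α) := by
  unfold measure radialMeasure
  rw [prod_withDensity_right (by fun_prop)]
  congr 1
  have : {x : Space d | 0 < x.2} = univ ×ˢ Ioi (0 : ℝ) := by ext; simp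
  rw [this, Measure.volume_eq_prod, ← Measure.prod_restrict, Measure.restrict_univ]

instance : SigmaFinite (measure d α) := by
  rw [measure_eq_prod]
  infer_instance

lemma ae_measure_pos : ∀ᵐ x ∂(measure d α), 0 < x.2 := by
  refine (withDensity_absolutelyContinuous _ _).ae_le ?_
  exact ae_restrict_mem (measurableSet_lt measurable_const measurable_snd)

lemma integral_radialMeasure (hα : -1 / 2 < α) (f : ℝ → ℂ) :
    ∫ r, f r ∂(radialMeasure d α) =
      ((((2 * Real.pi) ^ d * (2 : ℝ) ^ (2 * α) * Real.Gamma (α + 1) ^ 2)⁻¹ : ℝ) : ℂ) *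
        ∫ r in Ioi (0 : ℝ), ((r ^ (2 * α + 1) : ℝ) : ℂ) * f r := by
  unfold radialMeasure
  rw [integral_withDensity_eq_integral_toReal_smul (by fun_prop) (by simp), ← integral_const_mul]
  refine setIntegral_congr_fun measurableSet_Ioi fun r hr => ?_
  have hr : 0 < r := hr
  have h1 : 0 < Real.Gamma (α + 1) := Real.Gamma_pos_of_pos (by linarith)
  have hpi := Real.pi_pos
  rw [ENNReal.toReal_ofReal (by positivity), Complex.real_smul]
  push_cast
  ring

/-- A Gaussian on `ℝᵈ × ℝ`, modulated by a complex exponential of the first variable. -/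
def gauss (s : ℝ) (z : Fin d → ℂ) (x : Space d) : ℂ :=
  Complex.exp (-(s / 2 : ℂ) * ∑ i, ((x.1 i : ℝ) : ℂ) ^ 2 + ∑ i, z i * ((x.1 i : ℝ) : ℂ)) *
    (Real.exp (-(s / 2) * x.2 ^ 2) : ℂ)

@[fun_prop]
lemma continuous_gauss (s : ℝ) (z : Fin d → ℂ) : Continuous (gauss s z) := by
  unfold gauss
  fun_prop

lemma gauss_mul_gauss (s t : ℝ) (z w : Fin d → ℂ) (x : Space d) :
    gauss s z x * gauss t w x = gauss (s + t) (z + w) x := by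
  unfold gauss
  rw [mul_mul_mul_comm, ← Complex.exp_add, ← Complex.ofReal_mul, ← Real.exp_add]
  simp only [Pi.add_apply, add_mul, Finset.sum_add_distrib]
  congr 2
  · push_cast; ring
  · congr 1; ring

lemma conj_gauss (s : ℝ) (z : Fin d → ℂ) (x : Space d) :
    conj (gauss s z x) = gauss s (fun i => conj (z i)) x := by
  unfold gauss
  rw [map_mul, Complex.conj_ofReal, ← Complex.exp_conj]
  have h2 : conj (2 : ℂ) = 2 := map_ofNat _ 2
  simp [Complex.conj_ofReal, h2]

/-- The absolute value stays inside the family, with real parameters, so questions of integrability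
become evaluations of integrals of the same family. -/
lemma norm_gauss (s : ℝ) (z : Fin d → ℂ) (x : Space d) :
    (‖gauss s z x‖ : ℂ) = gauss s (fun i => ((z i).re : ℂ)) x := by
  unfold gauss
  rw [norm_mul, Complex.norm_real, Real.norm_of_nonneg (Real.exp_pos _).le, Complex.norm_exp,
    Complex.ofReal_mul]
  congr 1
  rw [Complex.ofReal_exp]
  congr 1
  have : ((-(s / 2 : ℂ) * ∑ i, ((x.1 i : ℝ) : ℂ) ^ 2 + ∑ i, z i * ((x.1 i : ℝ) : ℂ))).re =
      -(s / 2) * ∑ i, (x.1 i) ^ 2 + ∑ i, (z i).re * x.1 i := by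
    have h1 : -(s / 2 : ℂ) * ∑ i, ((x.1 i : ℝ) : ℂ) ^ 2 =
      ((-(s / 2) * ∑ i, (x.1 i) ^ 2 : ℝ) : ℂ) := by push_cast; ring
    rw [Complex.add_re, h1, Complex.ofReal_re, Complex.re_sum]
    simp
  rw [this]
  push_cast
  ring

/-- The constant in the integrals of Gaussians. -/
def gaussConst (d : ℕ) (α : ℝ) : ℝ :=
  (2 * Real.pi) ^ ((d : ℝ) / 2) * (2 ^ (α + 1) / 2 * Real.Gamma (α + 1)) /
    ((2 * Real.pi) ^ d * (2 : ℝ) ^ (2 * α) * Real.Gamma (α + 1) ^ 2)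

lemma gaussConst_pos (hα : -1 / 2 < α) : 0 < gaussConst d α := by
  have h1 : 0 < Real.Gamma (α + 1) := Real.Gamma_pos_of_pos (by linarith)
  have hpi := Real.pi_pos
  unfold gaussConst
  positivity

lemma integral_gauss_euclidean {s : ℝ} (hs : 0 < s) (z : Fin d → ℂ) :
    ∫ v : EuclideanSpace ℝ (Fin d),
      Complex.exp (-(s / 2 : ℂ) * ∑ i, ((v i : ℝ) : ℂ) ^ 2 + ∑ i, z i * ((v i : ℝ) : ℂ)) =
      (((2 * Real.pi) ^ ((d : ℝ) / 2) * s ^ (-((d : ℝ) / 2)) : ℝ) : ℂ) *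
        Complex.exp ((∑ i, z i ^ 2) / (2 * s)) := by
  rw [← (PiLp.volume_preserving_toLp (Fin d)).integral_comp
    (MeasurableEquiv.toLp 2 _).measurableEmbedding]
  have hb : 0 < (s / 2 : ℂ).re := by
    rw [show (s / 2 : ℂ) = ((s / 2 : ℝ) : ℂ) by push_cast; ring, Complex.ofReal_re]
    positivity
  have h := GaussianFourier.integral_cexp_neg_mul_sum_add hb z
  have hpi := Real.pi_pos
  have e1 : ((Real.pi : ℂ) / (s / 2 : ℂ)) ^ ((Fintype.card (Fin d) : ℂ) / 2) =
      (((2 * Real.pi) ^ ((d : ℝ) / 2) * s ^ (-((d : ℝ) / 2)) : ℝ) : ℂ) := by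
    rw [Fintype.card_fin, Real.rpow_neg hs.le, ← div_eq_mul_inv,
      ← Real.div_rpow (by positivity) hs.le, Complex.ofReal_cpow (by positivity)]
    push_cast
    congr 1
    field_simp
  rw [e1] at h
  refine h.trans ?_
  congr 2
  ring

/-- The integral of a Gaussian times a Bessel function of the last variable. -/
lemma integral_gauss_mul_besselSeries (hα : -1 / 2 < α) {s : ℝ} (hs : 0 < s) (z : Fin d → ℂ)
    (a : ℂ) :
    ∫ x, gauss s z x * besselSeries α (a * (x.2 : ℂ) ^ 2) ∂(measure d α) =
      ((gaussConst d α * s ^ (-(α + 1 + d / 2)) : ℝ) : ℂ) *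
        Complex.exp ((∑ i, z i ^ 2 + a) / (2 * s)) := by
  unfold gauss
  simp_rw [mul_assoc]
  rw [measure_eq_prod]
  rw [integral_prod_mul (f := fun v : EuclideanSpace ℝ (Fin d) =>
      Complex.exp (-(s / 2 : ℂ) * ∑ i, ((v i : ℝ) : ℂ) ^ 2 + ∑ i, z i * ((v i : ℝ) : ℂ)))
    (g := fun r : ℝ => (Real.exp (-(s / 2) * r ^ 2) : ℂ) * besselSeries α (a * (r : ℂ) ^ 2)),
    integral_gauss_euclidean hs, integral_radialMeasure hα]
  have h := integral_gaussian_mul_besselSeries hα hs a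
  simp_rw [Complex.ofReal_mul, mul_assoc] at h
  rw [h, add_div, Complex.exp_add]
  have e1 : (s / 2) ^ (-(α + 1)) = s ^ (-(α + 1)) * 2 ^ (α + 1) := by
    rw [Real.div_rpow hs.le (by norm_num), Real.rpow_neg (by norm_num : (0 : ℝ) ≤ 2)]
    field_simp
  have e2 : s ^ (-(α + 1 + d / 2)) = s ^ (-(α + 1)) * s ^ (-((d : ℝ) / 2)) := by
    rw [← Real.rpow_add hs]; ring_nf
  rw [e1, e2]
  unfold gaussConst
  push_cast
  ring

/-- The Bochner integral of a non-integrable function is 0 by convention, whereas the computed value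
is a nonzero constant times an exponential. -/
lemma integrable_gauss_mul_besselSeries (hα : -1 / 2 < α) {s : ℝ} (hs : 0 < s) (z : Fin d → ℂ)
    (a : ℂ) :
    Integrable (fun x => gauss s z x * besselSeries α (a * (x.2 : ℂ) ^ 2)) (measure d α) := by
  by_contra h
  have := integral_gauss_mul_besselSeries hα hs z a
  rw [integral_undef h] at this
  have h2 : (gaussConst d α * s ^ (-(α + 1 + d / 2)) : ℝ) ≠ 0 := by
    have := gaussConst_pos (d := d) hα
    positivity
  exact (mul_ne_zero (Complex.ofReal_ne_zero.2 h2) (Complex.exp_ne_zero _)) this.symm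

lemma besselSeries_zero (hα : -1 / 2 < α) : besselSeries α 0 = 1 := by
  unfold besselSeries
  rw [tsum_eq_single 0 (fun k hk => by simp [hk])]
  simp [besselCoeff_zero hα]

lemma integral_gauss (hα : -1 / 2 < α) {s : ℝ} (hs : 0 < s) (z : Fin d → ℂ) :
    ∫ x, gauss s z x ∂(measure d α) =
      ((gaussConst d α * s ^ (-(α + 1 + d / 2)) : ℝ) : ℂ) *
        Complex.exp ((∑ i, z i ^ 2) / (2 * s)) := by
  simpa [besselSeries_zero hα] using integral_gauss_mul_besselSeries hα hs z 0

lemma integrable_gauss (hα : -1 / 2 < α) {s : ℝ} (hs : 0 < s) (z : Fin d → ℂ) :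
    Integrable (gauss s z) (measure d α) := by
  simpa [besselSeries_zero hα] using integrable_gauss_mul_besselSeries hα hs z 0

lemma memLp_one_gauss (hα : -1 / 2 < α) {s : ℝ} (hs : 0 < s) (z : Fin d → ℂ) :
    MemLp (gauss s z) 1 (measure d α) := memLp_one_iff_integrable.2 (integrable_gauss hα hs z)

lemma memLp_two_gauss (hα : -1 / 2 < α) {s : ℝ} (hs : 0 < s) (z : Fin d → ℂ) :
    MemLp (gauss s z) 2 (measure d α) := by
  rw [memLp_two_iff_integrable_sq_norm (continuous_gauss s z).aestronglyMeasurable]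
  refine (integrable_gauss hα (by positivity : 0 < s + s)
    ((fun i => ((z i).re : ℂ)) + (fun i => ((z i).re : ℂ)))).norm.congr (ae_of_all _ fun x => ?_)
  simp only
  rw [← gauss_mul_gauss, ← norm_gauss, norm_mul, Complex.norm_real, norm_norm, sq]

/-! ### Uniqueness: Gaussian integrals determine measures, functions and a dense subspace of L². -/

/-- Finite measures are determined by the integrals of the functions in a self-conjugate
multiplicative family of bounded continuous functions that separates points. -/
lemma measure_ext_of_submonoid {E : Type*} [MeasurableSpace E] [TopologicalSpace E] [PolishSpace E]
    [BorelSpace E] {P P' : Measure E} [IsFiniteMeasure P] [IsFiniteMeasure P']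
    (S : Submonoid (BoundedContinuousFunction E ℂ)) (hstar : ∀ f ∈ S, star f ∈ S)
    (hsep : ∀ x y : E, x ≠ y → ∃ f ∈ S, f x ≠ f y)
    (h : ∀ f ∈ S, ∫ x, f x ∂P = ∫ x, f x ∂P') : P = P' := by
  -- The span of a multiplicative family is already an algebra, so closure under `star` and equality
  -- of integrals need only be checked on `S` and extended linearly.
  have hspan : ∀ f, f ∈ Algebra.adjoin ℂ (S : Set (BoundedContinuousFunction E ℂ)) ↔
      f ∈ Submodule.span ℂ (S : Set (BoundedContinuousFunction E ℂ)) := by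
    intro f
    rw [← Subalgebra.mem_toSubmodule, Algebra.adjoin_eq_span, Submonoid.closure_eq]
  let A : StarSubalgebra ℂ (BoundedContinuousFunction E ℂ) :=
    { Algebra.adjoin ℂ (S : Set (BoundedContinuousFunction E ℂ)) with
      star_mem' := by
        intro f hf
        change f ∈ Algebra.adjoin ℂ (S : Set (BoundedContinuousFunction E ℂ)) at hf
        change star f ∈ Algebra.adjoin ℂ (S : Set (BoundedContinuousFunction E ℂ))
        rw [hspan] at hf ⊢
        induction hf using Submodule.span_induction with
        | mem f hf => exact Submodule.subset_span (hstar f hf)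
        | zero => simp
        | add f g _ _ hf hg => rw [star_add]; exact Submodule.add_mem _ hf hg
        | smul c f _ hf => rw [star_smul]; exact Submodule.smul_mem _ _ hf }
  have hA : ∀ f, f ∈ A ↔ f ∈ Submodule.span ℂ (S : Set (BoundedContinuousFunction E ℂ)) := hspan
  refine ext_of_forall_mem_subalgebra_integral_eq_of_polish (𝕜 := ℂ) (A := A) ?_ ?_
  · intro x y hxy
    obtain ⟨f, hf, hne⟩ := hsep x y hxy
    refine ⟨f, ⟨f.toContinuousMapStarₐ ℂ, ?_, rfl⟩, hne⟩
    exact ⟨f, (hA f).2 (Submodule.subset_span hf), rfl⟩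
  · intro f hf
    rw [hA] at hf
    induction hf using Submodule.span_induction with
    | mem f hf => exact h f hf
    | zero => simp
    | add f g _ _ hf hg =>
      simp only [BoundedContinuousFunction.coe_add, Pi.add_apply]
      rw [integral_add (f.integrable _) (g.integrable _),
        integral_add (f.integrable _) (g.integrable _), hf, hg]
    | smul c f _ hf =>
      simp only [BoundedContinuousFunction.coe_smul, smul_eq_mul]
      rw [integral_const_mul, integral_const_mul, hf]

lemma norm_gauss_I_le {s : ℝ} (hs : 0 ≤ s) (η : Fin d → ℝ) (x : Space d) :
    ‖gauss s (fun i => η i * Complex.I) x‖ ≤ 1 := by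
  have h := norm_gauss s (fun i => η i * Complex.I) x
  have h0 : (fun i => (((η i * Complex.I).re : ℝ) : ℂ)) = 0 := by ext; simp
  rw [h0] at h
  unfold gauss at h ⊢
  have e : -(s / 2 : ℂ) * ∑ i, ((x.1 i : ℝ) : ℂ) ^ 2 + ∑ i, (0 : Fin d → ℂ) i * ((x.1 i : ℝ) : ℂ) =
      ((-(s / 2) * ∑ i, (x.1 i) ^ 2 : ℝ) : ℂ) := by push_cast; simp
  rw [e, ← Complex.ofReal_exp, ← Complex.ofReal_mul, Complex.ofReal_inj] at h
  rw [h, ← Real.exp_add]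
  refine Real.exp_le_one_iff.2 ?_
  have h1 : 0 ≤ s / 2 * ∑ i, (x.1 i) ^ 2 := mul_nonneg (by positivity) (Finset.sum_nonneg fun i _ => sq_nonneg _)
  have h2 : 0 ≤ s / 2 * x.2 ^ 2 := by positivity
  linarith

/-- Two finite measures on the half space with the same integrals of modulated Gaussians agree. -/
lemma finite_measure_ext_of_integral_gauss {ρ₁ ρ₂ : Measure (Space d)} [IsFiniteMeasure ρ₁]
    [IsFiniteMeasure ρ₂] (h₁ : ∀ᵐ x ∂ρ₁, 0 < x.2) (h₂ : ∀ᵐ x ∂ρ₂, 0 < x.2)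
    (h : ∀ (s : ℝ) (η : Fin d → ℝ), 0 ≤ s → ∫ x, gauss s (fun i => η i * Complex.I) x ∂ρ₁ =
      ∫ x, gauss s (fun i => η i * Complex.I) x ∂ρ₂) : ρ₁ = ρ₂ := by
  -- Gaussians are even in the last variable, so they do not separate points of ℝᵈ × ℝ. They do on
  -- ℝᵈ × [0, ∞), which is Polish, and no mass is lost because both measures live on x_{d+1} > 0.
  let q : Space d → EuclideanSpace ℝ (Fin d) × NNReal := fun x => (x.1, x.2.toNNReal)
  let p : EuclideanSpace ℝ (Fin d) × NNReal → Space d := fun y => (y.1, (y.2 : ℝ))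
  have hq : Measurable q := by fun_prop
  have hp : Measurable p := by fun_prop
  have hpc : Continuous p := by fun_prop
  have hpq : ∀ ρ : Measure (Space d), (∀ᵐ x ∂ρ, 0 < x.2) → (ρ.map q).map p = ρ := by
    intro ρ hρ
    rw [Measure.map_map hp hq]
    have : p ∘ q =ᵐ[ρ] id := by
      filter_upwards [hρ] with x hx
      simp [p, q, hx.le]
    rw [Measure.map_congr this, Measure.map_id]
  rw [← hpq ρ₁ h₁, ← hpq ρ₂ h₂]
  congr 1
  let S : Submonoid (BoundedContinuousFunction (EuclideanSpace ℝ (Fin d) × NNReal) ℂ) :=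
    { carrier := {f | ∃ (s : ℝ) (η : Fin d → ℝ), 0 ≤ s ∧
        ∀ y, f y = gauss s (fun i => η i * Complex.I) (p y)}
      one_mem' := ⟨0, 0, le_rfl, fun y => by simp [gauss]⟩
      mul_mem' := by
        rintro f g ⟨s, η, hs, hf⟩ ⟨t, ζ, ht, hg⟩
        refine ⟨s + t, η + ζ, by positivity, fun y => ?_⟩
        rw [BoundedContinuousFunction.mul_apply, hf, hg, gauss_mul_gauss]
        congr 1
        ext i
        simp [add_mul] }
  have hS : ∀ (s : ℝ) (η : Fin d → ℝ), 0 ≤ s → ∃ f ∈ S,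
      ∀ y, f y = gauss s (fun i => η i * Complex.I) (p y) := by
    intro s η hs
    exact ⟨BoundedContinuousFunction.ofNormedAddCommGroup
      (fun y => gauss s (fun i => η i * Complex.I) (p y)) (by fun_prop) 1
      (fun y => norm_gauss_I_le hs η _), ⟨s, η, hs, fun y => rfl⟩, fun y => rfl⟩
  refine measure_ext_of_submonoid S ?_ ?_ ?_
  · rintro f ⟨s, η, hs, hf⟩
    refine ⟨s, -η, hs, fun y => ?_⟩
    rw [BoundedContinuousFunction.star_apply, hf]
    change conj _ = _
    rw [conj_gauss]
    congr 1
    ext i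
    simp
  · intro y y' hne
    by_cases hv : y.1 = y'.1
    · obtain ⟨f, hf, hfy⟩ := hS 1 0 zero_le_one
      refine ⟨f, hf, fun heq => hne (Prod.ext hv ?_)⟩
      rw [hfy, hfy] at heq
      simp only [gauss, p, hv] at heq
      have := mul_left_cancel₀ (Complex.exp_ne_zero _) heq
      rw [Complex.ofReal_inj, Real.exp_eq_exp, mul_right_inj' (by norm_num)] at this
      exact NNReal.eq ((pow_left_inj₀ y.2.2 y'.2.2 two_ne_zero).1 this)
    · obtain ⟨i, hi⟩ : ∃ i, y.1 i ≠ y'.1 i := by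
        by_contra hcon
        push Not at hcon
        exact hv (PiLp.ext hcon)
      have hi' : y.1 i - y'.1 i ≠ 0 := sub_ne_zero.2 hi
      -- This frequency makes the values at y and y' differ by the factor e^{iπ} = -1.
      obtain ⟨f, hf, hfy⟩ := hS 0 (Pi.single i (Real.pi / (y.1 i - y'.1 i))) le_rfl
      refine ⟨f, hf, fun heq => ?_⟩
      rw [hfy, hfy] at heq
      have e : ∀ w : EuclideanSpace ℝ (Fin d) × NNReal,
          gauss 0 (fun j => ((Pi.single i (Real.pi / (y.1 i - y'.1 i)) : Fin d → ℝ) j : ℂ) *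
            Complex.I) (p w) =
            Complex.exp (((Real.pi / (y.1 i - y'.1 i) : ℝ) : ℂ) * Complex.I * (w.1 i : ℂ)) := by
        intro w
        have h1 : ∑ j, ((Pi.single i (Real.pi / (y.1 i - y'.1 i)) : Fin d → ℝ) j : ℂ) *
            Complex.I * (w.1 j : ℂ) =
            ((Real.pi / (y.1 i - y'.1 i) : ℝ) : ℂ) * Complex.I * (w.1 i : ℂ) := by
          rw [Finset.sum_eq_single i (fun j _ hj => by simp [hj]) (by simp)]
          simp
        simp only [gauss, p]
        rw [h1]
        simp
      rw [e, e, ← div_eq_one_iff_eq (Complex.exp_ne_zero _), ← Complex.exp_sub] at heq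
      have e2 : ((Real.pi / (y.1 i - y'.1 i) : ℝ) : ℂ) * Complex.I * (y.1 i : ℂ) -
          ((Real.pi / (y.1 i - y'.1 i) : ℝ) : ℂ) * Complex.I * (y'.1 i : ℂ) =
          Real.pi * Complex.I := by
        have : (y.1 i : ℂ) - (y'.1 i : ℂ) ≠ 0 := by
          rw [← Complex.ofReal_sub]; exact Complex.ofReal_ne_zero.2 hi'
        push_cast
        field_simp
      rw [e2, Complex.exp_pi_mul_I] at heq
      norm_num at heq
  · rintro f ⟨s, η, hs, hf⟩
    rw [integral_map hq.aemeasurable f.continuous.aestronglyMeasurable,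
      integral_map hq.aemeasurable f.continuous.aestronglyMeasurable]
    have e : ∀ ρ : Measure (Space d), (∀ᵐ x ∂ρ, 0 < x.2) →
        ∫ x, f (q x) ∂ρ = ∫ x, gauss s (fun i => η i * Complex.I) x ∂ρ := by
      intro ρ hρ
      refine integral_congr_ae ?_
      filter_upwards [hρ] with x hx
      rw [hf]
      simp [p, q, hx.le]
    rw [e _ h₁, e _ h₂, h s η hs]

lemma gauss_one_zero_ne_zero (x : Space d) : gauss 1 0 x ≠ 0 := by
  unfold gauss
  exact mul_ne_zero (Complex.exp_ne_zero _) (Complex.ofReal_ne_zero.2 (Real.exp_pos _).ne')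

lemma norm_gauss_zero (s : ℝ) (x : Space d) : (‖gauss s 0 x‖ : ℂ) = gauss s 0 x := by
  rw [norm_gauss]
  congr 1

/-- Two measures on the half space with the same integrals of modulated Gaussians agree. -/
lemma measure_ext_of_integral_gauss {ρ₁ ρ₂ : Measure (Space d)}
    (h₁ : ∀ᵐ x ∂ρ₁, 0 < x.2) (h₂ : ∀ᵐ x ∂ρ₂, 0 < x.2)
    (i₁ : Integrable (gauss 1 0) ρ₁) (i₂ : Integrable (gauss 1 0) ρ₂)
    (h : ∀ (s : ℝ) (η : Fin d → ℝ), 1 ≤ s → ∫ x, gauss s (fun i => η i * Complex.I) x ∂ρ₁ =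
      ∫ x, gauss s (fun i => η i * Complex.I) x ∂ρ₂) : ρ₁ = ρ₂ := by
  -- Weighting by the nowhere vanishing Gaussian with s = 1 gives finite measures and can be undone.
  -- It shifts s to 1 + s, which is why testing with s ≥ 1 suffices.
  have hm : Measurable fun x : Space d => ‖gauss 1 0 x‖ₑ := by fun_prop
  have hE : ∀ (ρ : Measure (Space d)) (s : ℝ) (η : Fin d → ℝ),
      ∫ x, gauss s (fun i => η i * Complex.I) x ∂(ρ.withDensity fun x => ‖gauss 1 0 x‖ₑ) =
      ∫ x, gauss (1 + s) (fun i => η i * Complex.I) x ∂ρ := by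
    intro ρ s η
    rw [integral_withDensity_eq_integral_toReal_smul hm (by simp)]
    congr 1
    ext x
    rw [toReal_enorm, Complex.real_smul, norm_gauss_zero, gauss_mul_gauss, zero_add]
  have hinv : ∀ ρ : Measure (Space d),
      (ρ.withDensity fun x => ‖gauss 1 0 x‖ₑ).withDensity (fun x => ‖gauss 1 0 x‖ₑ)⁻¹ = ρ := by
    intro ρ
    exact withDensity_inv_same hm (ae_of_all _ fun x => by simpa using gauss_one_zero_ne_zero x)
      (by simp)
  have f₁ : IsFiniteMeasure (ρ₁.withDensity fun x => ‖gauss 1 0 x‖ₑ) :=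
    isFiniteMeasure_withDensity i₁.2.ne
  have f₂ : IsFiniteMeasure (ρ₂.withDensity fun x => ‖gauss 1 0 x‖ₑ) :=
    isFiniteMeasure_withDensity i₂.2.ne
  rw [← hinv ρ₁, ← hinv ρ₂]
  congr 1
  refine finite_measure_ext_of_integral_gauss ((withDensity_absolutelyContinuous _ _).ae_le h₁)
    ((withDensity_absolutelyContinuous _ _).ae_le h₂) fun s η hs => ?_
  rw [hE, hE, h _ _ (by linarith)]

lemma norm_gauss_I_le_gauss_one {s : ℝ} (hs : 1 ≤ s) (η : Fin d → ℝ) (x : Space d) :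
    ‖gauss s (fun i => η i * Complex.I) x‖ ≤ ‖gauss 1 0 x‖ := by
  have e : gauss s (fun i => η i * Complex.I) x =
      gauss (s - 1) (fun i => η i * Complex.I) x * gauss 1 0 x := by
    rw [gauss_mul_gauss, add_zero, sub_add_cancel]
  rw [e, norm_mul]
  exact mul_le_of_le_one_left (norm_nonneg _) (norm_gauss_I_le (by linarith) η x)

lemma integrable_mul_gauss {w : Space d → ℂ} {μ : Measure (Space d)}
    (hw : AEStronglyMeasurable w μ) (hi : Integrable (fun x => w x * gauss 1 0 x) μ)
    {s : ℝ} (hs : 1 ≤ s) (η : Fin d → ℝ) :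
    Integrable (fun x => w x * gauss s (fun i => η i * Complex.I) x) μ := by
  refine Integrable.mono hi (hw.mul (continuous_gauss _ _).aestronglyMeasurable)
    (ae_of_all _ fun x => ?_)
  rw [norm_mul, norm_mul]
  gcongr
  exact norm_gauss_I_le_gauss_one hs η x

/-- The positive and negative parts of r, taken as densities, define two measures with the same
Gaussian integrals. These measures agree, so r⁺ = r⁻ almost everywhere, and both vanish since at
each point one of them is 0. -/
lemma ae_eq_zero_of_integral_gauss_real {r : Space d → ℝ} {μ : Measure (Space d)} [SigmaFinite μ]
    (hμ : ∀ᵐ x ∂μ, 0 < x.2) (hr : AEStronglyMeasurable r μ)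
    (hi : Integrable (fun x => (r x : ℂ) * gauss 1 0 x) μ)
    (h : ∀ (s : ℝ) (η : Fin d → ℝ), 1 ≤ s →
      ∫ x, (r x : ℂ) * gauss s (fun i => η i * Complex.I) x ∂μ = 0) : r =ᵐ[μ] 0 := by
  have hmp : AEMeasurable (fun x => ENNReal.ofReal (r x)) μ := hr.aemeasurable.ennreal_ofReal
  have hmn : AEMeasurable (fun x => ENNReal.ofReal (-r x)) μ := hr.aemeasurable.neg.ennreal_ofReal
  have hrc : AEStronglyMeasurable (fun x => (r x : ℂ)) μ :=
    Complex.continuous_ofReal.comp_aestronglyMeasurable hr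
  have hp : ∀ (s : ℝ) (η : Fin d → ℝ), 1 ≤ s → Integrable (fun x =>
      (ENNReal.ofReal (r x)).toReal • gauss s (fun i => η i * Complex.I) x) μ := by
    intro s η hs
    refine Integrable.mono (integrable_mul_gauss hrc hi hs η)
      (hmp.ennreal_toReal.aestronglyMeasurable.smul (continuous_gauss _ _).aestronglyMeasurable)
      (ae_of_all _ fun x => ?_)
    rw [norm_smul, norm_mul, Complex.norm_real]
    gcongr
    rw [ENNReal.toReal_ofReal', Real.norm_eq_abs, Real.norm_eq_abs,
      abs_of_nonneg (le_max_right _ _)]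
    exact max_le (le_abs_self _) (abs_nonneg _)
  have hn : ∀ (s : ℝ) (η : Fin d → ℝ), 1 ≤ s → Integrable (fun x =>
      (ENNReal.ofReal (-r x)).toReal • gauss s (fun i => η i * Complex.I) x) μ := by
    intro s η hs
    refine Integrable.mono (integrable_mul_gauss hrc hi hs η)
      (hmn.ennreal_toReal.aestronglyMeasurable.smul (continuous_gauss _ _).aestronglyMeasurable)
      (ae_of_all _ fun x => ?_)
    rw [norm_smul, norm_mul, Complex.norm_real]
    gcongr
    rw [ENNReal.toReal_ofReal', Real.norm_eq_abs, Real.norm_eq_abs,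
      abs_of_nonneg (le_max_right _ _)]
    exact max_le (neg_le_abs _) (abs_nonneg _)
  have e0 : (fun i : Fin d => (((0 : Fin d → ℝ) i : ℝ) : ℂ) * Complex.I) = 0 := by ext; simp
  have key : μ.withDensity (fun x => ENNReal.ofReal (r x)) =
      μ.withDensity (fun x => ENNReal.ofReal (-r x)) := by
    refine measure_ext_of_integral_gauss ((withDensity_absolutelyContinuous _ _).ae_le hμ)
      ((withDensity_absolutelyContinuous _ _).ae_le hμ) ?_ ?_ fun s η hs => ?_
    · rw [integrable_withDensity_iff_integrable_smul₀' hmp (by simp)]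
      have := hp 1 0 le_rfl
      rwa [e0] at this
    · rw [integrable_withDensity_iff_integrable_smul₀' hmn (by simp)]
      have := hn 1 0 le_rfl
      rwa [e0] at this
    · rw [integral_withDensity_eq_integral_toReal_smul₀ hmp (by simp),
        integral_withDensity_eq_integral_toReal_smul₀ hmn (by simp), ← sub_eq_zero,
        ← integral_sub (hp s η hs) (hn s η hs), ← h s η hs]
      congr 1
      ext x
      rw [← sub_smul, ENNReal.toReal_ofReal', ENNReal.toReal_ofReal', Complex.real_smul]
      congr 2
      rcases le_total 0 (r x) with h' | h'
      · rw [max_eq_left h', max_eq_right (by linarith)]; ring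
      · rw [max_eq_right h', max_eq_left (by linarith)]; ring
  rw [withDensity_eq_iff_of_sigmaFinite hmp hmn] at key
  filter_upwards [key] with x hx
  have := congrArg ENNReal.toReal hx
  rw [ENNReal.toReal_ofReal', ENNReal.toReal_ofReal'] at this
  rcases le_total 0 (r x) with h' | h'
  · rw [max_eq_left h', max_eq_right (by linarith)] at this; exact this
  · rw [max_eq_right h', max_eq_left (by linarith)] at this; simp; linarith

/-- A function on the half space whose integrals against all modulated Gaussians vanish is zero. -/
lemma ae_eq_zero_of_integral_gauss {w : Space d → ℂ} {μ : Measure (Space d)} [SigmaFinite μ]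
    (hμ : ∀ᵐ x ∂μ, 0 < x.2) (hw : AEStronglyMeasurable w μ)
    (hi : Integrable (fun x => w x * gauss 1 0 x) μ)
    (h : ∀ (s : ℝ) (η : Fin d → ℝ), 1 ≤ s →
      ∫ x, w x * gauss s (fun i => η i * Complex.I) x ∂μ = 0) : w =ᵐ[μ] 0 := by
  have hcw : AEStronglyMeasurable (fun x => conj (w x)) μ :=
    Complex.continuous_conj.comp_aestronglyMeasurable hw
  have hci : Integrable (fun x => conj (w x) * gauss 1 0 x) μ := by
    refine hi.mono (hcw.mul (continuous_gauss _ _).aestronglyMeasurable) (ae_of_all _ fun x => ?_)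
    simp
  -- Conjugation sends η to -η, so the hypothesis passes to the conjugate of w and hence to its real
  -- and imaginary parts.
  have hc : ∀ (s : ℝ) (η : Fin d → ℝ), 1 ≤ s →
      ∫ x, conj (w x) * gauss s (fun i => η i * Complex.I) x ∂μ = 0 := by
    intro s η hs
    have := congrArg conj (h s (-η) hs)
    rw [← integral_conj, map_zero] at this
    rw [← this]
    congr 1
    ext x
    rw [map_mul, conj_gauss]
    congr 2
    ext i
    simp
  have hre : (fun x => (w x).re) =ᵐ[μ] 0 := by
    have e : ∀ x, (((w x).re : ℝ) : ℂ) = (1 / 2) * (w x + conj (w x)) := fun x => by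
      rw [Complex.add_conj]; push_cast; ring
    refine ae_eq_zero_of_integral_gauss_real hμ
      (Complex.continuous_re.comp_aestronglyMeasurable hw) ?_ fun s η hs => ?_
    · simp_rw [e, mul_assoc, add_mul]
      exact (hi.add hci).const_mul _
    · simp_rw [e, mul_assoc, add_mul]
      rw [integral_const_mul, integral_add (integrable_mul_gauss hw hi hs η)
        (integrable_mul_gauss hcw hci hs η), h s η hs, hc s η hs]
      simp
  have him : (fun x => (w x).im) =ᵐ[μ] 0 := by
    have e : ∀ x, (((w x).im : ℝ) : ℂ) = (1 / (2 * Complex.I)) * (w x - conj (w x)) := fun x => by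
      rw [Complex.sub_conj]; push_cast; field_simp
    refine ae_eq_zero_of_integral_gauss_real hμ
      (Complex.continuous_im.comp_aestronglyMeasurable hw) ?_ fun s η hs => ?_
    · simp_rw [e, mul_assoc, sub_mul]
      exact (hi.sub hci).const_mul _
    · simp_rw [e, mul_assoc, sub_mul]
      rw [integral_const_mul, integral_sub (integrable_mul_gauss hw hi hs η)
        (integrable_mul_gauss hcw hci hs η), h s η hs, hc s η hs]
      simp
  filter_upwards [hre, him] with x h1 h2
  exact Complex.ext h1 h2

/-- The Gaussians as elements of `L²_α`. -/
def gaussL2 (hα : -1 / 2 < α) (i : Ioi (0 : ℝ) × (Fin d → ℂ)) : L2 d α :=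
  (memLp_two_gauss hα i.1.2 i.2).toLp _

lemma coeFn_gaussL2 (hα : -1 / 2 < α) (i : Ioi (0 : ℝ) × (Fin d → ℂ)) :
    gaussL2 hα i =ᵐ[measure d α] gauss i.1 i.2 := MemLp.coeFn_toLp _

/-- An element of the orthogonal complement has vanishing integral against every modulated Gaussian,
so it is zero by the uniqueness result. -/
lemma dense_span_gaussL2 (hα : -1 / 2 < α) :
    (Submodule.span ℂ (range (gaussL2 (d := d) hα))).topologicalClosure = ⊤ := by
  rw [Submodule.topologicalClosure_eq_top_iff, Submodule.eq_bot_iff]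
  intro u hu
  rw [Submodule.mem_orthogonal] at hu
  rw [Lp.eq_zero_iff_ae_eq_zero]
  refine ae_eq_zero_of_integral_gauss ae_measure_pos (Lp.aestronglyMeasurable u) ?_ fun s η hs => ?_
  · exact MemLp.integrable_mul (p := 2) (q := 2) (Lp.memLp u) (memLp_two_gauss hα one_pos 0)
  · have := hu (gaussL2 hα (⟨s, lt_of_lt_of_le one_pos hs⟩, fun i => ((-η i : ℝ) : ℂ) * Complex.I))
      (Submodule.subset_span (mem_range_self _))
    rw [L2.inner_def] at this
    rw [← this]
    refine integral_congr_ae ?_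
    filter_upwards [coeFn_gaussL2 hα (d := d)
      (⟨s, lt_of_lt_of_le one_pos hs⟩, fun i => ((-η i : ℝ) : ℂ) * Complex.I)] with x hx
    rw [hx, RCLike.inner_apply, conj_gauss]
    congr 2
    ext i
    simp

/-! ### The integral transform: bounds, transposition, Gaussians. -/

lemma continuous_kernel (hα : -1 / 2 < α) :
    Continuous fun p : Space d × Space d => kernel α p.1 p.2 := by
  unfold kernel
  have := continuous_besselJ hα
  fun_prop

lemma norm_kernel_le (hα : -1 / 2 < α) (x ξ : Space d) : ‖kernel α x ξ‖ ≤ 1 := by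
  unfold kernel
  rw [norm_mul, show -Complex.I * ((inner ℝ x.1 ξ.1 : ℝ) : ℂ) =
    ((-(inner ℝ x.1 ξ.1 : ℝ) : ℝ) : ℂ) * Complex.I by push_cast; ring,
    Complex.norm_exp_ofReal_mul_I, one_mul]
  exact norm_besselJ_le hα _

lemma kernel_comm (x ξ : Space d) : kernel α x ξ = kernel α ξ x := by
  unfold kernel
  rw [real_inner_comm, mul_comm x.2]

lemma integrable_mul_kernel (hα : -1 / 2 < α) {f : Space d → ℂ} (hf : Integrable f (measure d α))
    (ξ : Space d) : Integrable (fun x => f x * kernel α x ξ) (measure d α) := by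
  refine hf.mul_bdd (c := 1) ?_ (ae_of_all _ fun x => norm_kernel_le hα x ξ)
  exact ((continuous_kernel hα).comp (by fun_prop : Continuous fun x : Space d =>
    (x, ξ))).aestronglyMeasurable

lemma continuous_integralTransform (hα : -1 / 2 < α) {f : Space d → ℂ}
    (hf : Integrable f (measure d α)) : Continuous (integralTransform α f) := by
  unfold integralTransform
  refine continuous_of_dominated (bound := fun x => ‖f x‖)
    (fun ξ => (integrable_mul_kernel hα hf ξ).aestronglyMeasurable)
    (fun ξ => ae_of_all _ fun x => ?_) hf.norm (ae_of_all _ fun x => ?_)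
  · rw [norm_mul]
    exact mul_le_of_le_one_right (norm_nonneg _) (norm_kernel_le hα x ξ)
  · have hJ := continuous_besselJ hα
    unfold kernel
    fun_prop

lemma norm_integralTransform_le (hα : -1 / 2 < α) {f : Space d → ℂ}
    (hf : Integrable f (measure d α)) (ξ : Space d) :
    ‖integralTransform α f ξ‖ ≤ ∫ x, ‖f x‖ ∂(measure d α) := by
  refine norm_integral_le_of_norm_le hf.norm (ae_of_all _ fun x => ?_)
  rw [norm_mul]
  exact mul_le_of_le_one_right (norm_nonneg _) (norm_kernel_le hα x ξ)

lemma integrable_integralTransform_mul (hα : -1 / 2 < α) {f g : Space d → ℂ}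
    (hf : Integrable f (measure d α)) (hg : Integrable g (measure d α)) :
    Integrable (fun ξ => integralTransform α f ξ * g ξ) (measure d α) := by
  have hm : AEStronglyMeasurable (integralTransform α f) (measure d α) :=
    (continuous_integralTransform hα hf).aestronglyMeasurable
  exact hg.bdd_mul (c := ∫ x, ‖f x‖ ∂(measure d α)) hm
    (ae_of_all _ fun ξ => norm_integralTransform_le hα hf ξ)

/-- The transposition formula `∫ F(f) g = ∫ f F(g)`. -/
lemma integral_integralTransform_mul (hα : -1 / 2 < α) {f g : Space d → ℂ}
    (hf : Integrable f (measure d α)) (hg : Integrable g (measure d α)) :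
    ∫ ξ, integralTransform α f ξ * g ξ ∂(measure d α) =
      ∫ x, f x * integralTransform α g x ∂(measure d α) := by
  unfold integralTransform
  simp_rw [← integral_mul_const, ← integral_const_mul]
  rw [integral_integral_swap]
  · congr 1
    ext x
    congr 1
    ext ξ
    rw [kernel_comm]
    ring
  · have h := (hg.mul_prod hf).mul_bdd (c := 1)
      (continuous_kernel hα).aestronglyMeasurable (ae_of_all _ fun p => norm_kernel_le hα p.1 p.2)
    refine h.congr (ae_of_all _ fun p => ?_)
    simp only [Function.uncurry]
    rw [kernel_comm]
    ring

/-- The index of the transform of a Gaussian. -/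
def hatIndex (i : Ioi (0 : ℝ) × (Fin d → ℂ)) : Ioi (0 : ℝ) × (Fin d → ℂ) :=
  (⟨(i.1 : ℝ)⁻¹, mem_Ioi.2 (inv_pos.2 i.1.2)⟩, fun j => -Complex.I * i.2 j / (i.1 : ℝ))

/-- The coefficient of the transform of a Gaussian. -/
def hatCoeff (α : ℝ) (i : Ioi (0 : ℝ) × (Fin d → ℂ)) : ℂ :=
  ((gaussConst d α * (i.1 : ℝ) ^ (-(α + 1 + d / 2)) : ℝ) : ℂ) *
    Complex.exp ((∑ j, i.2 j ^ 2) / (2 * (i.1 : ℝ)))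

lemma hatCoeff_ne_zero (hα : -1 / 2 < α) (i : Ioi (0 : ℝ) × (Fin d → ℂ)) : hatCoeff α i ≠ 0 := by
  unfold hatCoeff
  have h1 : (0 : ℝ) < i.1 := i.1.2
  have h2 : (gaussConst d α * (i.1 : ℝ) ^ (-(α + 1 + d / 2)) : ℝ) ≠ 0 := by
    have := gaussConst_pos (d := d) hα
    positivity
  exact mul_ne_zero (Complex.ofReal_ne_zero.2 h2) (Complex.exp_ne_zero _)

/-- The exponential in the kernel only shifts z by -iξ'. This is why z is allowed to be complex: the
transform of a Gaussian becomes an integral already evaluated. -/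
lemma gauss_mul_kernel (s : ℝ) (z : Fin d → ℂ) (x ξ : Space d) :
    gauss s z x * kernel α x ξ = gauss s (fun j => z j - Complex.I * ξ.1 j) x *
      besselSeries α (-(ξ.2 : ℂ) ^ 2 * (x.2 : ℂ) ^ 2) := by
  unfold kernel
  rw [besselJ_eq, ← mul_assoc]
  congr 1
  · unfold gauss
    rw [mul_right_comm, ← Complex.exp_add]
    congr 2
    rw [add_assoc]
    congr 1
    rw [PiLp.inner_apply, Complex.ofReal_sum, Finset.mul_sum, ← Finset.sum_add_distrib]
    refine Finset.sum_congr rfl fun j _ => ?_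
    simp only [RCLike.inner_apply, conj_trivial]
    push_cast
    ring
  · congr 1
    push_cast
    ring

/-- The Weinstein transform of a Gaussian. -/
lemma integralTransform_gauss (hα : -1 / 2 < α) (i : Ioi (0 : ℝ) × (Fin d → ℂ)) (ξ : Space d) :
    integralTransform α (gauss i.1 i.2) ξ =
      hatCoeff α i * gauss (hatIndex i).1 (hatIndex i).2 ξ := by
  obtain ⟨⟨s, hs⟩, z⟩ := i
  have hs : 0 < s := hs
  have hs' : (s : ℂ) ≠ 0 := Complex.ofReal_ne_zero.2 hs.ne'
  unfold integralTransform
  simp_rw [gauss_mul_kernel]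
  rw [integral_gauss_mul_besselSeries hα hs]
  simp only [hatCoeff, hatIndex, gauss]
  rw [Complex.ofReal_exp, mul_assoc _ (Complex.exp _), ← Complex.exp_add, ← Complex.exp_add]
  congr 2
  have : ∀ j, (z j - Complex.I * ξ.1 j) ^ 2 =
      z j ^ 2 - (ξ.1 j : ℂ) ^ 2 - 2 * Complex.I * (z j * ξ.1 j) := fun j => by
    ring_nf; rw [Complex.I_sq]; ring
  simp_rw [this]
  rw [Finset.sum_sub_distrib, Finset.sum_sub_distrib, ← Finset.mul_sum]
  have h2 : ∑ j, -Complex.I * z j / (s : ℂ) * (ξ.1 j : ℂ) =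
      -Complex.I / s * ∑ j, z j * (ξ.1 j : ℂ) := by
    rw [Finset.mul_sum]
    refine Finset.sum_congr rfl fun j _ => ?_
    ring
  rw [h2]
  push_cast
  field_simp
  ring

/-! ### The Plancherel theorem. -/

lemma inner_gaussL2 (hα : -1 / 2 < α) (i j : Ioi (0 : ℝ) × (Fin d → ℂ)) :
    inner ℂ (gaussL2 hα i) (gaussL2 hα j) =
      ((gaussConst d α * ((i.1 : ℝ) + j.1) ^ (-(α + 1 + d / 2)) : ℝ) : ℂ) *
        Complex.exp ((∑ k, (conj (i.2 k) + j.2 k) ^ 2) / (2 * ((i.1 : ℝ) + j.1 : ℝ))) := by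
  have h1 : (0 : ℝ) < i.1 := i.1.2
  have h2 : (0 : ℝ) < j.1 := j.1.2
  have h := integral_gauss (d := d) hα (add_pos h1 h2) ((fun k => conj (i.2 k)) + j.2)
  simp only [Pi.add_apply] at h
  rw [← h, L2.inner_def]
  refine integral_congr_ae ?_
  filter_upwards [coeFn_gaussL2 hα i, coeFn_gaussL2 hα j] with x hx hy
  rw [hx, hy, RCLike.inner_apply, conj_gauss, mul_comm, gauss_mul_gauss]

/-- Parseval for Gaussians. The powers match because st(1/s + 1/t) = s + t, and the exponents match
coordinate by coordinate as quadratic polynomials in conj z and w. -/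
lemma inner_hat_gaussL2 (hα : -1 / 2 < α) (i j : Ioi (0 : ℝ) × (Fin d → ℂ)) :
    inner ℂ (hatCoeff α i • gaussL2 hα (hatIndex i)) (hatCoeff α j • gaussL2 hα (hatIndex j)) =
      (gaussConst d α : ℂ) ^ 2 * inner ℂ (gaussL2 hα i) (gaussL2 hα j) := by
  rw [inner_smul_left, inner_smul_right, inner_gaussL2, inner_gaussL2]
  obtain ⟨⟨s, hs⟩, z⟩ := i
  obtain ⟨⟨t, ht⟩, w⟩ := j
  have hs : 0 < s := hs
  have ht : 0 < t := ht
  have hs' : (s : ℂ) ≠ 0 := Complex.ofReal_ne_zero.2 hs.ne'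
  have ht' : (t : ℂ) ≠ 0 := Complex.ofReal_ne_zero.2 ht.ne'
  have hst' : (s : ℂ) + t ≠ 0 := by
    rw [← Complex.ofReal_add]; exact Complex.ofReal_ne_zero.2 (by positivity)
  simp only [hatCoeff, hatIndex]
  have hr : (s⁻¹ + t⁻¹) ^ (-(α + 1 + d / 2)) * (s ^ (-(α + 1 + d / 2)) * t ^ (-(α + 1 + d / 2))) =
      (s + t) ^ (-(α + 1 + d / 2)) := by
    rw [← Real.mul_rpow hs.le ht.le, ← Real.mul_rpow (by positivity) (by positivity)]
    congr 1
    field_simp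
    ring
  have h2 : conj (2 : ℂ) = 2 := map_ofNat _ 2
  rw [map_mul, Complex.conj_ofReal, ← Complex.exp_conj, map_div₀, map_mul, Complex.conj_ofReal,
    map_sum, h2, ← hr]
  simp only [map_pow, map_div₀, map_mul, map_neg, Complex.conj_I, Complex.conj_ofReal]
  have he : Complex.exp ((∑ k, (conj (z k) + w k) ^ 2) / (2 * ((s + t : ℝ) : ℂ))) =
      Complex.exp ((∑ k, conj (z k) ^ 2) / (2 * (s : ℂ))) *
      (Complex.exp ((∑ k, w k ^ 2) / (2 * (t : ℂ))) *
      Complex.exp ((∑ k, (- -Complex.I * conj (z k) / (s : ℂ) + -Complex.I * w k / (t : ℂ)) ^ 2) /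
        (2 * ((s⁻¹ + t⁻¹ : ℝ) : ℂ)))) := by
    rw [← Complex.exp_add, ← Complex.exp_add]
    congr 1
    simp_rw [Finset.sum_div]
    rw [← Finset.sum_add_distrib, ← Finset.sum_add_distrib]
    refine Finset.sum_congr rfl fun k _ => ?_
    have hI : (- -Complex.I * conj (z k) / (s : ℂ) + -Complex.I * w k / (t : ℂ)) ^ 2 =
        -(conj (z k) / s - w k / t) ^ 2 := by
      linear_combination (conj (z k) / s - w k / t) ^ 2 * Complex.I_sq
    rw [hI]
    push_cast
    have hst2 : (s : ℂ)⁻¹ + (t : ℂ)⁻¹ = (s + t) / (s * t) := by field_simp; ring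
    rw [hst2]
    field_simp
    ring
  rw [he]
  push_cast
  ring

/-- The linear combinations of Gaussians. -/
def gaussSum (hα : -1 / 2 < α) : ((Ioi (0 : ℝ) × (Fin d → ℂ)) →₀ ℂ) →ₗ[ℂ] L2 d α :=
  Finsupp.linearCombination ℂ (gaussL2 hα)

/-- The transforms of the linear combinations of Gaussians. -/
def hatGaussSum (hα : -1 / 2 < α) : ((Ioi (0 : ℝ) × (Fin d → ℂ)) →₀ ℂ) →ₗ[ℂ] L2 d α :=
  Finsupp.linearCombination ℂ fun i => hatCoeff α i • gaussL2 hα (hatIndex i)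

lemma denseRange_gaussSum (hα : -1 / 2 < α) : DenseRange (gaussSum (d := d) hα) := by
  have h := dense_span_gaussL2 (d := d) hα
  rw [← Finsupp.range_linearCombination, ← Submodule.dense_iff_topologicalClosure_eq_top] at h
  exact h

lemma inner_hatGaussSum (hα : -1 / 2 < α) (u v : (Ioi (0 : ℝ) × (Fin d → ℂ)) →₀ ℂ) :
    inner ℂ (hatGaussSum hα u) (hatGaussSum hα v) =
      (gaussConst d α : ℂ) ^ 2 * inner ℂ (gaussSum hα u) (gaussSum hα v) := by
  induction u using Finsupp.induction_linear with
  | zero => simp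
  | add u u' hu hu' => rw [map_add, map_add, inner_add_left, inner_add_left, hu, hu', mul_add]
  | single i a =>
    induction v using Finsupp.induction_linear with
    | zero => simp
    | add v v' hv hv' => rw [map_add, map_add, inner_add_right, inner_add_right, hv, hv', mul_add]
    | single j b =>
      simp only [hatGaussSum, gaussSum, Finsupp.linearCombination_single]
      rw [inner_smul_left, inner_smul_right, inner_hat_gaussL2, inner_smul_left, inner_smul_right]
      ring

lemma norm_hatGaussSum (hα : -1 / 2 < α) (u : (Ioi (0 : ℝ) × (Fin d → ℂ)) →₀ ℂ) :
    ‖hatGaussSum hα u‖ = gaussConst d α * ‖gaussSum hα u‖ := by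
  have h := inner_hatGaussSum hα u u
  rw [inner_self_eq_norm_sq_to_K, inner_self_eq_norm_sq_to_K, ← mul_pow] at h
  have hK := (gaussConst_pos (d := d) hα).le
  have h' : ‖hatGaussSum hα u‖ ^ 2 = (gaussConst d α * ‖gaussSum hα u‖) ^ 2 := by
    apply Complex.ofReal_injective
    push_cast
    exact h
  exact (pow_left_inj₀ (norm_nonneg _) (by positivity) two_ne_zero).1 h'

lemma isTransformExtension_apply_gaussL2 (hα : -1 / 2 < α) {T : L2 d α →L[ℂ] L2 d α}
    (hT : IsTransformExtension T) (i : Ioi (0 : ℝ) × (Fin d → ℂ)) :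
    T (gaussL2 hα i) = hatCoeff α i • gaussL2 hα (hatIndex i) := by
  apply Lp.ext
  filter_upwards [hT _ (memLp_one_gauss hα i.1.2 i.2) (memLp_two_gauss hα i.1.2 i.2),
    Lp.coeFn_smul (hatCoeff α i) (gaussL2 hα (hatIndex i)), coeFn_gaussL2 hα (hatIndex i)]
    with ξ h1 h2 h3
  rw [h2, Pi.smul_apply, h3, smul_eq_mul, ← integralTransform_gauss hα, ← h1]
  rfl

lemma integral_mul_gauss_eq_inner (hα : -1 / 2 < α) (u : L2 d α)
    (i : Ioi (0 : ℝ) × (Fin d → ℂ)) :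
    ∫ x, u x * gauss i.1 i.2 x ∂(measure d α) =
      inner ℂ (gaussL2 hα (i.1, fun j => conj (i.2 j))) u := by
  rw [L2.inner_def]
  refine integral_congr_ae ?_
  filter_upwards [coeFn_gaussL2 hα (i.1, fun j => conj (i.2 j))] with x hx
  rw [hx, RCLike.inner_apply, conj_gauss]
  simp

/-- Transposition for an operator that has the right values on Gaussians. -/
lemma integral_mul_gauss_of_apply_gaussL2 (hα : -1 / 2 < α) {T : L2 d α →L[ℂ] L2 d α}
    (hT : ∀ i, T (gaussL2 hα i) = hatCoeff α i • gaussL2 hα (hatIndex i)) (u : L2 d α)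
    (i : Ioi (0 : ℝ) × (Fin d → ℂ)) :
    ∫ x, T u x * gauss i.1 i.2 x ∂(measure d α) =
      ∫ x, u x * integralTransform α (gauss i.1 i.2) x ∂(measure d α) := by
  have e : ∀ v : L2 d α, ∫ x, v x * integralTransform α (gauss i.1 i.2) x ∂(measure d α) =
      hatCoeff α i * ∫ x, v x * gauss (hatIndex i).1 (hatIndex i).2 x ∂(measure d α) := by
    intro v
    rw [← integral_const_mul]
    congr 1
    ext x
    rw [integralTransform_gauss hα]
    ring
  rw [e, integral_mul_gauss_eq_inner hα, integral_mul_gauss_eq_inner hα]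
  -- Both sides are continuous linear functionals of u, so it suffices to compare them on Gaussians,
  -- where the claim is transposition for integrable functions.
  have key : (innerSL ℂ (gaussL2 hα (i.1, fun j => conj (i.2 j)))) ∘L T =
      hatCoeff α i • innerSL ℂ (gaussL2 hα ((hatIndex i).1, fun j => conj ((hatIndex i).2 j))) := by
    refine ContinuousLinearMap.ext_on
      (Submodule.dense_iff_topologicalClosure_eq_top.2 (dense_span_gaussL2 hα)) ?_
    rintro _ ⟨k, rfl⟩
    simp only [ContinuousLinearMap.comp_apply, innerSL_apply_apply, smul_apply,
      smul_eq_mul]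
    rw [← integral_mul_gauss_eq_inner hα, ← integral_mul_gauss_eq_inner hα, ← e]
    have e1 : ∫ x, T (gaussL2 hα k) x * gauss i.1 i.2 x ∂(measure d α) =
        ∫ x, integralTransform α (gauss k.1 k.2) x * gauss i.1 i.2 x ∂(measure d α) := by
      refine integral_congr_ae ?_
      rw [hT]
      filter_upwards [Lp.coeFn_smul (hatCoeff α k) (gaussL2 hα (hatIndex k)),
        coeFn_gaussL2 hα (hatIndex k)] with x h1 h2
      rw [h1, Pi.smul_apply, h2, smul_eq_mul, integralTransform_gauss hα]
    rw [e1, integral_integralTransform_mul hα (integrable_gauss hα k.1.2 _)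
      (integrable_gauss hα i.1.2 _)]
    refine integral_congr_ae ?_
    filter_upwards [coeFn_gaussL2 hα k] with x hx
    rw [hx]
  exact congrArg (fun L => L u) key

/-- The Plancherel theorem: the Weinstein transform extends continuously to `L²_α`. -/
lemma exists_isTransformExtension (hα : -1 / 2 < α) :
    ∃ T : L2 d α →L[ℂ] L2 d α, IsTransformExtension T := by
  -- The norm identity on combinations of Gaussians shows that the map depends only on the resulting
  -- function and is bounded, so it extends from a dense subspace.
  let T : L2 d α →L[ℂ] L2 d α := (hatGaussSum hα).extendOfNorm (gaussSum hα)
  have hT : ∀ i, T (gaussL2 hα i) = hatCoeff α i • gaussL2 hα (hatIndex i) := by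
    intro i
    have h := LinearMap.extendOfNorm_eq (denseRange_gaussSum (d := d) hα)
      ⟨gaussConst d α, fun u => (norm_hatGaussSum hα u).le⟩ (Finsupp.single i 1)
    have e1 : gaussSum hα (Finsupp.single i 1) = gaussL2 hα i := by simp [gaussSum]
    have e2 : hatGaussSum hα (Finsupp.single i 1) = hatCoeff α i • gaussL2 hα (hatIndex i) := by
      simp [hatGaussSum]
    rwa [e1, e2] at h
  refine ⟨T, fun f h1 h2 => ?_⟩
  have hf := memLp_one_iff_integrable.1 h1
  have hFm : AEStronglyMeasurable (integralTransform α f) (measure d α) :=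
    (continuous_integralTransform hα hf).aestronglyMeasurable
  have hi1 : ∀ i : Ioi (0 : ℝ) × (Fin d → ℂ), Integrable (fun x => T (h2.toLp f) x *
      gauss i.1 i.2 x) (measure d α) := fun i =>
    MemLp.integrable_mul (p := 2) (q := 2) (Lp.memLp _) (memLp_two_gauss hα i.1.2 _)
  have hi2 : ∀ i : Ioi (0 : ℝ) × (Fin d → ℂ), Integrable (fun x => integralTransform α f x *
      gauss i.1 i.2 x) (measure d α) := fun i =>
    integrable_integralTransform_mul hα hf (integrable_gauss hα i.1.2 _)
  -- On L¹ ∩ L², the extension and the integral formula satisfy the same transposition rule against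
  -- Gaussians, and uniqueness identifies them.
  have key : (fun x => T (h2.toLp f) x - integralTransform α f x) =ᵐ[measure d α] 0 := by
    refine ae_eq_zero_of_integral_gauss ae_measure_pos
      ((Lp.aestronglyMeasurable _).sub hFm) ?_ fun s η hs => ?_
    · simp_rw [sub_mul]
      exact (hi1 (⟨1, mem_Ioi.2 one_pos⟩, 0)).sub (hi2 (⟨1, mem_Ioi.2 one_pos⟩, 0))
    · let i : Ioi (0 : ℝ) × (Fin d → ℂ) :=
        (⟨s, lt_of_lt_of_le one_pos hs⟩, fun j => η j * Complex.I)
      simp_rw [sub_mul]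
      rw [integral_sub (hi1 i) (hi2 i), integral_mul_gauss_of_apply_gaussL2 hα hT _ i,
        integral_integralTransform_mul hα hf (integrable_gauss hα i.1.2 i.2), sub_eq_zero]
      refine integral_congr_ae ?_
      filter_upwards [h2.coeFn_toLp] with x hx
      rw [hx]
  filter_upwards [key] with x hx
  exact sub_eq_zero.1 hx

lemma isTransformExtension_transform (hα : -1 / 2 < α) :
    IsTransformExtension (transform (d := d) (α := α)) := by
  unfold transform
  rw [dif_pos (exists_isTransformExtension hα)]
  exact (exists_isTransformExtension hα).choose_spec

lemma transform_gaussL2 (hα : -1 / 2 < α) (i : Ioi (0 : ℝ) × (Fin d → ℂ)) :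
    transform (gaussL2 hα i) = hatCoeff α i • gaussL2 hα (hatIndex i) :=
  isTransformExtension_apply_gaussL2 hα (isTransformExtension_transform hα) i

lemma norm_transform (hα : -1 / 2 < α) (u : L2 d α) :
    ‖transform u‖ = gaussConst d α * ‖u‖ := by
  have h : ∀ v, transform (gaussSum (d := d) hα v) = hatGaussSum hα v := by
    intro v
    induction v using Finsupp.induction_linear with
    | zero => simp
    | add v w hv hw => rw [map_add, map_add, map_add, hv, hw]
    | single i a => simp [gaussSum, hatGaussSum, transform_gaussL2]
  refine (denseRange_gaussSum hα).induction_on u (isClosed_eq (by fun_prop) (by fun_prop))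
    fun v => ?_
  rw [h, norm_hatGaussSum]

/-- The Weinstein transform, normalized to be an isometry. -/
def transformIsometry (hα : -1 / 2 < α) : L2 d α →ₗᵢ[ℂ] L2 d α where
  toLinearMap := ((gaussConst d α : ℂ)⁻¹ • (transform (d := d) (α := α))).toLinearMap
  norm_map' u := by
    have hK := gaussConst_pos (d := d) hα
    change ‖(gaussConst d α : ℂ)⁻¹ • transform u‖ = ‖u‖
    rw [norm_smul, norm_transform hα, norm_inv, Complex.norm_real, Real.norm_of_nonneg hK.le,
      inv_mul_cancel_left₀ hK.ne']

lemma transform_eq_smul (hα : -1 / 2 < α) (u : L2 d α) :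
    transform u = (gaussConst d α : ℂ) • transformIsometry hα u := by
  have hK : (gaussConst d α : ℂ) ≠ 0 := Complex.ofReal_ne_zero.2 (gaussConst_pos (d := d) hα).ne'
  change _ = (gaussConst d α : ℂ) • ((gaussConst d α : ℂ)⁻¹ • transform u)
  rw [smul_inv_smul₀ hK]

/-- The Parseval formula. -/
lemma inner_transform (hα : -1 / 2 < α) (u v : L2 d α) :
    inner ℂ (transform u) (transform v) = (gaussConst d α : ℂ) ^ 2 * inner ℂ u v := by
  rw [transform_eq_smul hα, transform_eq_smul hα, inner_smul_left, inner_smul_right,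
    LinearIsometry.inner_map_map, Complex.conj_ofReal]
  ring

/-- The index whose transform is a given index. -/
lemma exists_hatIndex_eq (i : Ioi (0 : ℝ) × (Fin d → ℂ)) : ∃ j, hatIndex j = i := by
  obtain ⟨⟨s, hs⟩, z⟩ := i
  have hs : 0 < s := hs
  have hs' : (s : ℂ) ≠ 0 := Complex.ofReal_ne_zero.2 hs.ne'
  refine ⟨(⟨s⁻¹, mem_Ioi.2 (inv_pos.2 hs)⟩, fun j => Complex.I * z j / s), ?_⟩
  simp only [hatIndex, inv_inv]
  congr 1
  ext j
  push_cast
  field_simp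
  rw [Complex.I_sq]
  ring

/-- The range of an isometry of a complete space is closed, and this one contains every Gaussian,
since each is a multiple of the transform of another. -/
lemma transform_surjective (hα : -1 / 2 < α) :
    Function.Surjective (transform (d := d) (α := α)) := by
  have hK : (gaussConst d α : ℂ) ≠ 0 := Complex.ofReal_ne_zero.2 (gaussConst_pos (d := d) hα).ne'
  have hc : IsClosed ((transformIsometry (d := d) hα).range : Set (L2 d α)) :=
    (transformIsometry (d := d) hα).isometry.isClosedEmbedding.isClosed_range
  have htop : (transformIsometry (d := d) hα).range = ⊤ := by
    rw [eq_top_iff, ← dense_span_gaussL2 hα]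
    refine Submodule.topologicalClosure_minimal _ (Submodule.span_le.2 ?_) hc
    rintro _ ⟨i, rfl⟩
    obtain ⟨j, rfl⟩ := exists_hatIndex_eq i
    have hj := transform_gaussL2 hα j
    rw [transform_eq_smul hα] at hj
    refine ⟨((hatCoeff α j)⁻¹ * gaussConst d α) • gaussL2 hα j, ?_⟩
    change transformIsometry hα _ = _
    rw [map_smul, mul_smul, hj, inv_smul_smul₀ (hatCoeff_ne_zero hα j)]
  intro v
  obtain ⟨u, hu⟩ : v ∈ (transformIsometry (d := d) hα).range := htop ▸ Submodule.mem_top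
  refine ⟨(gaussConst d α : ℂ)⁻¹ • u, ?_⟩
  change transformIsometry hα u = v at hu
  rw [map_smul, transform_eq_smul hα, inv_smul_smul₀ hK, hu]

lemma transform_toLp (hα : -1 / 2 < α) {h : Space d → ℂ} (h1 : Integrable h (measure d α))
    (h2 : MemLp h 2 (measure d α)) :
    transform (h2.toLp h) =ᵐ[measure d α] integralTransform α h :=
  isTransformExtension_transform hα h (memLp_one_iff_integrable.2 h1) h2

/-- An integrable function with a square integrable transform is square integrable. -/
lemma memLp_two_of_integralTransform (hα : -1 / 2 < α) {h : Space d → ℂ}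
    (h1 : Integrable h (measure d α)) (h2 : MemLp (integralTransform α h) 2 (measure d α)) :
    MemLp h 2 (measure d α) := by
  -- H is the L² preimage of the transform of h. Transposition gives h and H the same Gaussian
  -- integrals, so h = H almost everywhere.
  obtain ⟨H, hH⟩ := transform_surjective hα (h2.toLp _)
  have hi1 : ∀ i : Ioi (0 : ℝ) × (Fin d → ℂ), Integrable (fun x => h x *
      gauss i.1 i.2 x) (measure d α) := by
    intro i
    obtain ⟨j, rfl⟩ := exists_hatIndex_eq i
    refine ((integrable_integralTransform_mul hα (integrable_gauss hα j.1.2 j.2) h1).const_mul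
      (hatCoeff α j)⁻¹).congr (ae_of_all _ fun x => ?_)
    simp only
    rw [integralTransform_gauss hα]
    have := hatCoeff_ne_zero hα j
    field_simp
  have hi2 : ∀ i : Ioi (0 : ℝ) × (Fin d → ℂ), Integrable (fun x => H x *
      gauss i.1 i.2 x) (measure d α) := fun i =>
    MemLp.integrable_mul (p := 2) (q := 2) (Lp.memLp _) (memLp_two_gauss hα i.1.2 _)
  have heq : ∀ i : Ioi (0 : ℝ) × (Fin d → ℂ), ∫ x, h x * gauss i.1 i.2 x ∂(measure d α) =
      ∫ x, H x * gauss i.1 i.2 x ∂(measure d α) := by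
    intro i
    obtain ⟨j, rfl⟩ := exists_hatIndex_eq i
    have e : ∀ v : Space d → ℂ, ∫ x, v x * integralTransform α (gauss j.1 j.2) x ∂(measure d α) =
        hatCoeff α j * ∫ x, v x * gauss (hatIndex j).1 (hatIndex j).2 x ∂(measure d α) := by
      intro v
      rw [← integral_const_mul]
      congr 1
      ext x
      rw [integralTransform_gauss hα]
      ring
    rw [← mul_right_inj' (hatCoeff_ne_zero hα j), ← e, ← e,
      ← integral_integralTransform_mul hα h1 (integrable_gauss hα j.1.2 _),
      ← integral_mul_gauss_of_apply_gaussL2 hα (transform_gaussL2 hα), hH]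
    refine integral_congr_ae ?_
    filter_upwards [h2.coeFn_toLp] with x hx
    rw [hx]
  have key : (fun x => h x - H x) =ᵐ[measure d α] 0 := by
    refine ae_eq_zero_of_integral_gauss ae_measure_pos
      (h1.aestronglyMeasurable.sub (Lp.aestronglyMeasurable _)) ?_ fun s η hs => ?_
    · simp_rw [sub_mul]
      exact (hi1 (⟨1, mem_Ioi.2 one_pos⟩, 0)).sub (hi2 (⟨1, mem_Ioi.2 one_pos⟩, 0))
    · let i : Ioi (0 : ℝ) × (Fin d → ℂ) :=
        (⟨s, lt_of_lt_of_le one_pos hs⟩, fun j => η j * Complex.I)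
      simp_rw [sub_mul]
      rw [integral_sub (hi1 i) (hi2 i), heq i, sub_self]
  refine (memLp_congr_ae ?_).2 (Lp.memLp H)
  filter_upwards [key] with x hx
  exact sub_eq_zero.1 hx

lemma lintegral_enorm_sq {X : Type*} [MeasurableSpace X] {μ : Measure X} (f : X → ℂ) :
    ∫⁻ x, ‖f x‖ₑ ^ 2 ∂μ = eLpNorm f 2 μ ^ 2 := by
  have h := eLpNorm_nnreal_pow_eq_lintegral (f := f) (μ := μ) (p := 2) two_ne_zero
  simp only [NNReal.coe_ofNat, ENNReal.rpow_ofNat, ENNReal.coe_ofNat] at h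
  exact h.symm

lemma memLp_two_iff_lintegral {X : Type*} [MeasurableSpace X] {μ : Measure X} {f : X → ℂ}
    (hf : AEStronglyMeasurable f μ) : MemLp f 2 μ ↔ ∫⁻ x, ‖f x‖ₑ ^ 2 ∂μ < ⊤ := by
  rw [lintegral_enorm_sq, MemLp]
  simp [hf, ENNReal.pow_lt_top_iff]

/-- Plancherel's identity for integrable functions, with both sides possibly infinite. -/
lemma lintegral_integralTransform_sq (hα : -1 / 2 < α) {h : Space d → ℂ}
    (h1 : Integrable h (measure d α)) :
    ∫⁻ ξ, ‖integralTransform α h ξ‖ₑ ^ 2 ∂(measure d α) =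
      ENNReal.ofReal (gaussConst d α) ^ 2 * ∫⁻ x, ‖h x‖ₑ ^ 2 ∂(measure d α) := by
  have hK := gaussConst_pos (d := d) hα
  by_cases h2 : MemLp h 2 (measure d α)
  · rw [lintegral_enorm_sq, lintegral_enorm_sq, ← mul_pow]
    congr 1
    rw [← eLpNorm_congr_ae (transform_toLp hα h1 h2), ← eLpNorm_congr_ae h2.coeFn_toLp,
      ← Lp.enorm_def, ← Lp.enorm_def, ← ofReal_norm, norm_transform hα, ENNReal.ofReal_mul hK.le,
      ofReal_norm]
  -- If h is not square integrable then neither is its transform, and both sides are infinite.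
  · have h3 : ¬ MemLp (integralTransform α h) 2 (measure d α) := fun h3 =>
      h2 (memLp_two_of_integralTransform hα h1 h3)
    rw [memLp_two_iff_lintegral h1.aestronglyMeasurable, not_lt, top_le_iff] at h2
    rw [memLp_two_iff_lintegral (continuous_integralTransform hα h1).aestronglyMeasurable, not_lt,
      top_le_iff] at h3
    rw [h2, h3, ENNReal.mul_top (by simpa using hK)]

/-! ### Generalized translation and dilation acting on μ_α. -/

/-- The argument of the function in the integral that defines the generalized translation. -/
def translationMap (x : Space d) (p : Space d × ℝ) : Space d :=
  (x.1 + p.1.1, Real.sqrt (x.2 ^ 2 + p.1.2 ^ 2 + 2 * x.2 * p.1.2 * Real.cos p.2))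

@[fun_prop]
lemma continuous_translationMap (x : Space d) : Continuous (translationMap x) := by
  unfold translationMap
  fun_prop

/-- The variables separate: θ enters only through exp(-s x_{d+1} y_{d+1} cos θ), whose integral over
θ is a modified Bessel function by Poisson's formula. -/
lemma gauss_translationMap (s : ℝ) (z : Fin d → ℂ) (x y : Space d) (θ : ℝ) :
    gauss s z (translationMap x (y, θ)) = gauss s z x *
      gauss s (fun i => z i - s * x.1 i) y *
      Complex.exp (((-(s * x.2 * y.2) : ℝ) : ℂ) * (Real.cos θ : ℂ)) := by
  have h0 : 0 ≤ x.2 ^ 2 + y.2 ^ 2 + 2 * x.2 * y.2 * Real.cos θ := by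
    nlinarith [sq_nonneg (x.2 + y.2 * Real.cos θ), sq_nonneg (y.2 * Real.sin θ),
      Real.sin_sq_add_cos_sq θ]
  simp only [gauss, translationMap]
  rw [Real.sq_sqrt h0, Complex.ofReal_exp, Complex.ofReal_exp, Complex.ofReal_exp,
    ← Complex.exp_add, ← Complex.exp_add, ← Complex.exp_add, ← Complex.exp_add,
    ← Complex.exp_add]
  congr 1
  have h1 : ∑ i, (((x.1 + y.1) i : ℝ) : ℂ) ^ 2 = ∑ i, ((x.1 i : ℝ) : ℂ) ^ 2 +
      ∑ i, ((y.1 i : ℝ) : ℂ) ^ 2 + 2 * ∑ i, (x.1 i : ℂ) * (y.1 i : ℂ) := by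
    rw [Finset.mul_sum, ← Finset.sum_add_distrib, ← Finset.sum_add_distrib]
    refine Finset.sum_congr rfl fun i _ => ?_
    rw [PiLp.add_apply]
    push_cast
    ring
  have h2 : ∑ i, z i * (((x.1 + y.1) i : ℝ) : ℂ) = ∑ i, z i * (x.1 i : ℂ) +
      ∑ i, z i * (y.1 i : ℂ) := by
    rw [← Finset.sum_add_distrib]
    refine Finset.sum_congr rfl fun i _ => ?_
    rw [PiLp.add_apply]
    push_cast
    ring
  have h3 : ∑ i, (z i - s * x.1 i) * (y.1 i : ℂ) = ∑ i, z i * (y.1 i : ℂ) -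
      s * ∑ i, (x.1 i : ℂ) * (y.1 i : ℂ) := by
    rw [Finset.mul_sum, ← Finset.sum_sub_distrib]
    refine Finset.sum_congr rfl fun i _ => ?_
    ring
  rw [h1, h2, h3]
  push_cast
  ring

/-- The generalized translation of a Gaussian, up to normalization, times a second Gaussian. -/
lemma integral_gauss_mul_gauss_translationMap_sin (hα : -1 / 2 < α) (t s : ℝ) (v z : Fin d → ℂ)
    (x y : Space d) :
    ∫ θ, gauss t v y * gauss s z (translationMap x (y, θ)) ∂(sinMeasure α) =
      sinMass α * gauss s z x * (gauss (t + s) (v + fun i => z i - s * x.1 i) y *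
        besselSeries α (((s * x.2 : ℝ) : ℂ) ^ 2 * (y.2 : ℂ) ^ 2)) := by
  rw [integral_const_mul]
  simp_rw [gauss_translationMap]
  rw [integral_const_mul, integral_exp_mul_cos hα, ← gauss_mul_gauss]
  have : ((-(s * x.2 * y.2) : ℝ) : ℂ) ^ 2 = ((s * x.2 : ℝ) : ℂ) ^ 2 * (y.2 : ℂ) ^ 2 := by
    push_cast; ring
  rw [this]
  ring

/-- The norm of the integrand is the same expression with v and z replaced by their real parts. Its
θ-integral is a Gaussian times a Bessel function, integrable because t + s > 0. -/
lemma integrable_gauss_mul_gauss_translationMap (hα : -1 / 2 < α) {t s : ℝ} (ht : 0 ≤ t)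
    (hs : 0 < s) (v z : Fin d → ℂ) (x : Space d) :
    Integrable (fun p : Space d × ℝ => gauss t v p.1 * gauss s z (translationMap x p))
      ((measure d α).prod (sinMeasure α)) := by
  have hfin := isFiniteMeasure_sinMeasure hα
  have hc : Continuous fun p : Space d × ℝ => gauss t v p.1 * gauss s z (translationMap x p) := by
    fun_prop
  rw [integrable_prod_iff hc.aestronglyMeasurable]
  refine ⟨ae_of_all _ fun y => integrable_sinMeasure hα (by fun_prop), ?_⟩
  have h := ((integrable_gauss_mul_besselSeries hα (add_pos_of_nonneg_of_pos ht hs)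
    ((fun i => ((v i).re : ℂ)) + fun i => ((z i).re : ℂ) - s * x.1 i)
    (((s * x.2 : ℝ) : ℂ) ^ 2)).const_mul
    (sinMass α * gauss s (fun i => ((z i).re : ℂ)) x)).re
  refine h.congr (ae_of_all _ fun y => ?_)
  simp only
  rw [← integral_gauss_mul_gauss_translationMap_sin hα t s (fun i => ((v i).re : ℂ))
    (fun i => ((z i).re : ℂ)) x y]
  simp_rw [← norm_gauss, ← Complex.ofReal_mul, ← norm_mul]
  rw [integral_complex_ofReal]
  exact Complex.ofReal_re _

lemma integral_gauss_mul_gauss_translationMap (hα : -1 / 2 < α) {t s : ℝ} (ht : 0 ≤ t)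
    (hs : 0 < s) (v z : Fin d → ℂ) (x : Space d) :
    ∫ p : Space d × ℝ, gauss t v p.1 * gauss s z (translationMap x p)
      ∂((measure d α).prod (sinMeasure α)) =
      sinMass α * gauss s z x * (((gaussConst d α * (t + s) ^ (-(α + 1 + d / 2)) : ℝ) : ℂ) *
        Complex.exp ((∑ i, (v i + (z i - s * x.1 i)) ^ 2 + ((s * x.2 : ℝ) : ℂ) ^ 2) /
          (2 * ((t + s : ℝ) : ℂ)))) := by
  have hfin := isFiniteMeasure_sinMeasure hα
  rw [integral_prod _ (integrable_gauss_mul_gauss_translationMap hα ht hs v z x)]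
  simp_rw [integral_gauss_mul_gauss_translationMap_sin hα]
  rw [integral_const_mul, integral_gauss_mul_besselSeries hα (add_pos_of_nonneg_of_pos ht hs)]
  simp only [Pi.add_apply]

lemma gauss_zero_zero (x : Space d) : gauss 0 0 x = 1 := by simp [gauss]

/-- The generalized translation preserves the measure, up to normalization. -/
lemma map_translationMap (hα : -1 / 2 < α) {x : Space d} (hx : 0 < x.2) :
    ((measure d α).prod (sinMeasure α)).map (translationMap x) =
      (sinMass α).toNNReal • measure d α := by
  have hfin := isFiniteMeasure_sinMeasure hα
  have hm := sinMass_pos hα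
  have hW : Measurable (translationMap x) := (continuous_translationMap x).measurable
  refine measure_ext_of_integral_gauss ?_ ?_ ?_ ?_ fun s η hs => ?_
  · rw [ae_map_iff hW.aemeasurable (measurableSet_lt measurable_const measurable_snd)]
    have h1 : ∀ᵐ p ∂((measure d α).prod (sinMeasure α)), 0 < p.1.2 :=
      Measure.quasiMeasurePreserving_fst.ae ae_measure_pos
    have h2 : ∀ᵐ p ∂((measure d α).prod (sinMeasure α)), p.2 ∈ Ioo 0 Real.pi :=
      Measure.quasiMeasurePreserving_snd.ae
        ((withDensity_absolutelyContinuous _ _).ae_le (ae_restrict_mem measurableSet_Ioo))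
    filter_upwards [h1, h2] with p h1 h2
    refine Real.sqrt_pos.2 ?_
    have hc : -1 < Real.cos p.2 := by
      rw [← Real.cos_pi]
      exact Real.cos_lt_cos_of_nonneg_of_le_pi h2.1.le le_rfl h2.2
    -- The radicand equals (x_{d+1} - y_{d+1})² + 2 x_{d+1} y_{d+1} (1 + cos θ), which is positive
    -- since θ < π.
    nlinarith [sq_nonneg (x.2 - p.1.2), mul_pos (mul_pos hx h1) (by linarith : 0 < Real.cos p.2 + 1)]
  · exact (Measure.smul_absolutelyContinuous).ae_le ae_measure_pos
  · rw [integrable_map_measure (continuous_gauss 1 0).aestronglyMeasurable hW.aemeasurable]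
    refine (integrable_gauss_mul_gauss_translationMap hα le_rfl one_pos 0 0 x).congr
      (ae_of_all _ fun p => ?_)
    simp [gauss_zero_zero]
  · exact (integrable_gauss hα one_pos 0).smul_measure_nnreal
  · have hs0 : 0 < s := by linarith
    have hs' : (s : ℂ) ≠ 0 := Complex.ofReal_ne_zero.2 hs0.ne'
    rw [integral_map hW.aemeasurable (continuous_gauss _ _).aestronglyMeasurable,
      integral_smul_nnreal_measure, integral_gauss hα hs0]
    -- With t = 0 and v = 0 the first Gaussian is the constant 1, so this is the integral of the
    -- translated Gaussian alone.
    have h := integral_gauss_mul_gauss_translationMap hα le_rfl hs0 0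
      (fun i => η i * Complex.I) x
    simp_rw [gauss_zero_zero, one_mul] at h
    rw [h, NNReal.smul_def, Real.coe_toNNReal _ hm.le, Complex.real_smul, mul_assoc]
    congr 1
    rw [mul_left_comm, zero_add]
    congr 1
    unfold gauss
    rw [Complex.ofReal_exp, ← Complex.exp_add, ← Complex.exp_add]
    congr 1
    have e : ∑ i, ((0 : Fin d → ℂ) i + (η i * Complex.I - s * x.1 i)) ^ 2 =
        ∑ i, (η i * Complex.I : ℂ) ^ 2 + s ^ 2 * ∑ i, (x.1 i : ℂ) ^ 2 -
          2 * s * ∑ i, (η i * Complex.I : ℂ) * (x.1 i : ℂ) := by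
      rw [Finset.mul_sum, Finset.mul_sum, ← Finset.sum_add_distrib, ← Finset.sum_sub_distrib]
      refine Finset.sum_congr rfl fun i _ => ?_
      simp only [Pi.zero_apply]
      ring
    rw [e]
    simp only
    generalize ∑ i, (η i * Complex.I : ℂ) * (x.1 i : ℂ) = A
    generalize ∑ i, (η i * Complex.I : ℂ) ^ 2 = B
    push_cast
    field_simp
    ring

lemma gauss_smul (s c : ℝ) (z : Fin d → ℂ) (x : Space d) :
    gauss s z (c • x) = gauss (c ^ 2 * s) (fun i => c * z i) x := by
  simp only [gauss, Prod.smul_fst, Prod.smul_snd, PiLp.smul_apply, smul_eq_mul]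
  congr 2
  · rw [Finset.mul_sum, Finset.mul_sum]
    congr 1
    · refine Finset.sum_congr rfl fun i _ => ?_
      push_cast
      ring
    · refine Finset.sum_congr rfl fun i _ => ?_
      push_cast
      ring
  · congr 1
    ring

/-- The scaling behaviour of the measure. -/
lemma map_smul_measure (hα : -1 / 2 < α) {c : ℝ} (hc : 0 < c) :
    (measure d α).map (fun x => c • x) =
      (c ^ (-(2 * α + d + 2))).toNNReal • measure d α := by
  have hm : Measurable fun x : Space d => c • x := measurable_const_smul c
  refine measure_ext_of_integral_gauss ?_ ?_ ?_ ?_ fun s η hs => ?_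
  · rw [ae_map_iff hm.aemeasurable (measurableSet_lt measurable_const measurable_snd)]
    filter_upwards [ae_measure_pos] with x hx
    exact mul_pos hc hx
  · exact (Measure.smul_absolutelyContinuous).ae_le ae_measure_pos
  · rw [integrable_map_measure (continuous_gauss 1 0).aestronglyMeasurable hm.aemeasurable]
    refine (integrable_gauss hα (by positivity : 0 < c ^ 2 * 1) (fun i => c * (0 : Fin d → ℂ) i)).congr
      (ae_of_all _ fun p => ?_)
    rw [Function.comp, gauss_smul]
  · exact (integrable_gauss hα one_pos 0).smul_measure_nnreal
  · have hs0 : 0 < s := by linarith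
    have hs' : (s : ℂ) ≠ 0 := Complex.ofReal_ne_zero.2 hs0.ne'
    have hc' : (c : ℂ) ≠ 0 := Complex.ofReal_ne_zero.2 hc.ne'
    rw [integral_map hm.aemeasurable (continuous_gauss _ _).aestronglyMeasurable,
      integral_smul_nnreal_measure, integral_gauss hα hs0]
    simp_rw [gauss_smul]
    rw [integral_gauss hα (by positivity), NNReal.smul_def, Real.coe_toNNReal _ (by positivity),
      Complex.real_smul, ← mul_assoc, ← Complex.ofReal_mul]
    congr 1
    · congr 1
      rw [Real.mul_rpow (by positivity) hs0.le, ← Real.rpow_natCast c 2, ← Real.rpow_mul hc.le,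
        mul_left_comm]
      congr 2
      push_cast
      ring
    · simp_rw [mul_pow (c : ℂ)]
      rw [← Finset.mul_sum]
      generalize ∑ i, (η i * Complex.I : ℂ) ^ 2 = B
      push_cast
      field_simp

/-! ### Composition on L² with maps that preserve a measure up to a factor. -/

section comp

variable {X Y : Type*} [MeasurableSpace X] [MeasurableSpace Y] {μ : Measure X} {ν : Measure Y}
  {T : X → Y} {c : NNReal}

lemma quasiMeasurePreserving_of_map_eq (hT : Measurable T) (h : μ.map T = c • ν) :
    Measure.QuasiMeasurePreserving T μ ν :=
  ⟨hT, h ▸ Measure.smul_absolutelyContinuous⟩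

lemma eLpNorm_comp_of_map_eq (hT : Measurable T) (h : μ.map T = c • ν) {f : Y → ℂ}
    (hf : AEStronglyMeasurable f ν) :
    eLpNorm (f ∘ T) 2 μ = (c : ENNReal) ^ (1 / 2 : ℝ) * eLpNorm f 2 ν := by
  rw [← eLpNorm_map_measure (h ▸ hf.smul_measure c) hT.aemeasurable, h,
    show c • ν = (c : ENNReal) • ν from rfl, eLpNorm_smul_measure_of_ne_top (by simp)]
  simp

lemma memLp_comp_of_map_eq (hT : Measurable T) (h : μ.map T = c • ν) {f : Y → ℂ}
    (hf : MemLp f 2 ν) : MemLp (f ∘ T) 2 μ := by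
  refine ⟨hf.1.comp_quasiMeasurePreserving (quasiMeasurePreserving_of_map_eq hT h), ?_⟩
  rw [eLpNorm_comp_of_map_eq hT h hf.1]
  exact ENNReal.mul_lt_top (ENNReal.rpow_lt_top_of_nonneg (by norm_num) ENNReal.coe_ne_top) hf.2

/-- Composition with a map that preserves the measure up to a factor, as an operator on `L²`. -/
def compL2 (hT : Measurable T) (h : μ.map T = c • ν) : Lp ℂ 2 ν →L[ℂ] Lp ℂ 2 μ :=
  LinearMap.mkContinuous
    { toFun := fun u => (memLp_comp_of_map_eq hT h (Lp.memLp u)).toLp (u ∘ T)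
      map_add' := fun u v => by
        rw [← MemLp.toLp_add (memLp_comp_of_map_eq hT h (Lp.memLp u))
          (memLp_comp_of_map_eq hT h (Lp.memLp v))]
        refine MemLp.toLp_congr _ _ ?_
        exact (quasiMeasurePreserving_of_map_eq hT h).ae_eq (Lp.coeFn_add u v)
      map_smul' := fun a u => by
        rw [RingHom.id_apply, ← MemLp.toLp_const_smul a (memLp_comp_of_map_eq hT h (Lp.memLp u))]
        refine MemLp.toLp_congr _ _ ?_
        exact (quasiMeasurePreserving_of_map_eq hT h).ae_eq (Lp.coeFn_smul a u) }
    ((c : ENNReal) ^ (1 / 2 : ℝ)).toReal fun u => by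
      change ‖(memLp_comp_of_map_eq hT h (Lp.memLp u)).toLp (u ∘ T)‖ ≤ _
      rw [Lp.norm_toLp, eLpNorm_comp_of_map_eq hT h (Lp.aestronglyMeasurable u),
        ENNReal.toReal_mul, Lp.norm_def]

lemma coeFn_compL2 (hT : Measurable T) (h : μ.map T = c • ν) (u : Lp ℂ 2 ν) :
    compL2 hT h u =ᵐ[μ] u ∘ T :=
  MemLp.coeFn_toLp (memLp_comp_of_map_eq hT h (Lp.memLp u))

end comp

/-! ### The spectral formula for the wavelet transform. -/

lemma gauss_mul_exp_eq {s t a : ℝ} (hs : 0 < s) (ht : 0 < t) (ha : 0 < a) (u v : Fin d → ℂ)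
    (x : Space d) :
    gauss (a⁻¹ ^ 2 * s) (fun k => (a⁻¹ : ℝ) * u k) x *
      Complex.exp ((∑ k, (v k + ((a⁻¹ : ℝ) * u k - (a⁻¹ ^ 2 * s : ℝ) * x.1 k)) ^ 2 +
        ((a⁻¹ ^ 2 * s * x.2 : ℝ) : ℂ) ^ 2) / (2 * ((t + a⁻¹ ^ 2 * s : ℝ) : ℂ))) =
    Complex.exp ((∑ k, v k ^ 2) / (2 * (t : ℂ))) * Complex.exp ((∑ k, u k ^ 2) / (2 * (s : ℂ))) *
      Complex.exp ((∑ k, (-Complex.I * v k / t + a * (Complex.I * u k / s) -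
        Complex.I * x.1 k) ^ 2 + -(x.2 : ℂ) ^ 2) / (2 * ((t⁻¹ + a ^ 2 * s⁻¹ : ℝ) : ℂ))) := by
  have hs' : (s : ℂ) ≠ 0 := Complex.ofReal_ne_zero.2 hs.ne'
  have ht' : (t : ℂ) ≠ 0 := Complex.ofReal_ne_zero.2 ht.ne'
  have ha' : (a : ℂ) ≠ 0 := Complex.ofReal_ne_zero.2 ha.ne'
  have hst : (s : ℂ) + a ^ 2 * t ≠ 0 := by
    have : s + a ^ 2 * t ≠ 0 := by positivity
    exact_mod_cast Complex.ofReal_ne_zero.2 this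
  have e1 : ((t + a⁻¹ ^ 2 * s : ℝ) : ℂ) = (s + a ^ 2 * t) / a ^ 2 := by
    push_cast; field_simp; ring
  have e2 : ((t⁻¹ + a ^ 2 * s⁻¹ : ℝ) : ℂ) = (s + a ^ 2 * t) / (s * t) := by
    push_cast; field_simp
  have e3 : ∀ k, (-Complex.I * v k / t + a * (Complex.I * u k / s) - Complex.I * x.1 k) ^ 2 =
      -(v k / t - a * u k / s + x.1 k) ^ 2 := fun k => by
    linear_combination (v k / t - a * u k / s + x.1 k) ^ 2 * Complex.I_sq
  simp_rw [e3]
  unfold gauss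
  rw [Complex.ofReal_exp, ← Complex.exp_add, ← Complex.exp_add, ← Complex.exp_add,
    ← Complex.exp_add, e1, e2]
  congr 1
  -- Both sides are single exponentials. Their exponents agree separately in each coordinate of x'
  -- (`hsum`) and in the last variable (`hr`).
  have hsum : ∑ k, (-((a⁻¹ ^ 2 * s : ℝ) / 2 : ℂ) * (x.1 k : ℂ) ^ 2 + (a⁻¹ : ℝ) * u k * x.1 k +
      (v k + ((a⁻¹ : ℝ) * u k - (a⁻¹ ^ 2 * s : ℝ) * x.1 k)) ^ 2 /
        (2 * ((s + a ^ 2 * t) / a ^ 2 : ℂ))) =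
      ∑ k, (v k ^ 2 / (2 * (t : ℂ)) + u k ^ 2 / (2 * (s : ℂ)) +
        -(v k / t - a * u k / s + x.1 k) ^ 2 / (2 * ((s + a ^ 2 * t) / (s * t) : ℂ))) := by
    refine Finset.sum_congr rfl fun k _ => ?_
    push_cast
    field_simp
    ring
  simp only [Finset.sum_add_distrib] at hsum
  rw [← Finset.mul_sum, ← Finset.sum_div, ← Finset.sum_div, ← Finset.sum_div, ← Finset.sum_div]
    at hsum
  have hr : ((-(a⁻¹ ^ 2 * s / 2) * x.2 ^ 2 : ℝ) : ℂ) + ((a⁻¹ ^ 2 * s * x.2 : ℝ) : ℂ) ^ 2 /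
      (2 * ((s + a ^ 2 * t) / a ^ 2 : ℂ)) =
      -(x.2 : ℂ) ^ 2 / (2 * ((s + a ^ 2 * t) / (s * t) : ℂ)) := by
    push_cast
    field_simp
    ring
  rw [add_div, add_div]
  linear_combination hsum + hr

/-- The function on the spectral side that represents the wavelet transform at scale `a`. -/
def waveletSymbol (u v : Space d → ℂ) (a : ℝ) (ξ : Space d) : ℂ := v ξ * conj (u (a • ξ))

/-- The spectral formula for a Gaussian wavelet (index i) and a Gaussian signal (index j). Both
sides have closed forms: the exponentials agree by `gauss_mul_exp_eq`, and the powers because t +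
s/a² = a^{-2} · ts · (1/t + a²/s). -/
lemma integral_gauss_translation_eq (hα : -1 / 2 < α) {a : ℝ} (ha : 0 < a) (x : Space d)
    (i j : Ioi (0 : ℝ) × (Fin d → ℂ)) :
    ∫ p : Space d × ℝ, gauss j.1 j.2 p.1 * conj (gauss i.1 i.2 (a⁻¹ • translationMap x p))
      ∂((measure d α).prod (sinMeasure α)) =
    ((sinMass α * a ^ (2 * α + d + 2) / gaussConst d α ^ 2 : ℝ) : ℂ) *
      integralTransform α (waveletSymbol
        (fun ξ => hatCoeff α i * gauss (hatIndex i).1 (hatIndex i).2 ξ)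
        (fun ξ => hatCoeff α j * gauss (hatIndex j).1 (hatIndex j).2 ξ) a) x := by
  obtain ⟨⟨s, hs⟩, z⟩ := i
  obtain ⟨⟨t, ht⟩, v⟩ := j
  have hs : 0 < s := hs
  have ht : 0 < t := ht
  have hK := gaussConst_pos (d := d) hα
  have hK' : (gaussConst d α : ℂ) ≠ 0 := Complex.ofReal_ne_zero.2 hK.ne'
  simp_rw [gauss_smul, conj_gauss, map_mul, Complex.conj_ofReal]
  rw [integral_gauss_mul_gauss_translationMap hα ht.le (by positivity)]
  have hR : integralTransform α (waveletSymbol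
        (fun ξ => hatCoeff α (⟨s, hs⟩, z) *
          gauss (hatIndex (⟨s, hs⟩, z)).1 (hatIndex (⟨s, hs⟩, z)).2 ξ)
        (fun ξ => hatCoeff α (⟨t, ht⟩, v) *
          gauss (hatIndex (⟨t, ht⟩, v)).1 (hatIndex (⟨t, ht⟩, v)).2 ξ) a) x =
      hatCoeff α (⟨t, ht⟩, v) * conj (hatCoeff α (⟨s, hs⟩, z)) *
      (((gaussConst d α * (t⁻¹ + a ^ 2 * s⁻¹) ^ (-(α + 1 + d / 2)) : ℝ) : ℂ) *
      Complex.exp ((∑ k, (-Complex.I * v k / t + a * (Complex.I * conj (z k) / s) -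
        Complex.I * x.1 k) ^ 2 + -(x.2 : ℂ) ^ 2) / (2 * ((t⁻¹ + a ^ 2 * s⁻¹ : ℝ) : ℂ)))) := by
    rw [← integral_gauss_mul_besselSeries hα (by positivity), ← integral_const_mul]
    unfold integralTransform waveletSymbol
    congr 1
    ext ξ
    rw [← gauss_mul_kernel, map_mul, gauss_smul, conj_gauss]
    simp only [hatIndex]
    rw [mul_mul_mul_comm, gauss_mul_gauss, mul_assoc]
    congr 3
    ext k
    simp [Complex.conj_ofReal]
  rw [hR]
  have hE := gauss_mul_exp_eq hs ht ha (fun k => conj (z k)) v x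
  have h2 : conj (2 : ℂ) = 2 := map_ofNat _ 2
  simp only [hatCoeff]
  rw [map_mul, Complex.conj_ofReal, ← Complex.exp_conj, map_div₀, map_mul, Complex.conj_ofReal,
    map_sum, h2]
  simp only [map_pow]
  have hr : (t + a⁻¹ ^ 2 * s) ^ (-(α + 1 + d / 2)) = a ^ (2 * α + d + 2) *
      (t ^ (-(α + 1 + d / 2)) * s ^ (-(α + 1 + d / 2)) *
        (t⁻¹ + a ^ 2 * s⁻¹) ^ (-(α + 1 + d / 2))) := by
    have e : t + a⁻¹ ^ 2 * s = a⁻¹ ^ 2 * (t * s * (t⁻¹ + a ^ 2 * s⁻¹)) := by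
      field_simp
      ring
    rw [e, Real.mul_rpow (by positivity) (by positivity), Real.mul_rpow (by positivity)
      (by positivity), Real.mul_rpow ht.le hs.le, inv_pow, ← Real.rpow_natCast a 2,
      ← Real.rpow_neg ha.le, ← Real.rpow_mul ha.le]
    congr 2
    push_cast
    ring
  rw [hr]
  calc _ = (sinMass α : ℂ) * ((gaussConst d α * (a ^ (2 * α + d + 2) *
      (t ^ (-(α + 1 + d / 2)) * s ^ (-(α + 1 + d / 2)) *
        (t⁻¹ + a ^ 2 * s⁻¹) ^ (-(α + 1 + d / 2)))) : ℝ) : ℂ) * (gauss (a⁻¹ ^ 2 * s)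
        (fun k => (a⁻¹ : ℝ) * conj (z k)) x *
      Complex.exp ((∑ k, (v k + ((a⁻¹ : ℝ) * conj (z k) - (a⁻¹ ^ 2 * s : ℝ) * x.1 k)) ^ 2 +
        ((a⁻¹ ^ 2 * s * x.2 : ℝ) : ℂ) ^ 2) / (2 * ((t + a⁻¹ ^ 2 * s : ℝ) : ℂ)))) := by ring
    _ = _ := by
      rw [hE]
      push_cast
      field_simp

lemma memLp_mul_of_norm_le_one {X : Type*} [MeasurableSpace X] {μ : Measure X} {f k : X → ℂ}
    (hf : MemLp f 2 μ) (hk : AEStronglyMeasurable k μ) (hb : ∀ x, ‖k x‖ ≤ 1) :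
    MemLp (fun x => f x * k x) 2 μ := by
  refine hf.mono (hf.1.mul hk) (ae_of_all _ fun x => ?_)
  rw [norm_mul]
  exact mul_le_of_le_one_right (norm_nonneg _) (hb x)

lemma aestronglyMeasurable_kernel (hα : -1 / 2 < α) (x : Space d) (μ : Measure (Space d)) :
    AEStronglyMeasurable (fun ξ => kernel α ξ x) μ :=
  ((continuous_kernel hα).comp (by fun_prop : Continuous fun ξ : Space d =>
    (ξ, x))).aestronglyMeasurable

lemma map_smul_translationMap (hα : -1 / 2 < α) {a : ℝ} (ha : 0 < a) {x : Space d}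
    (hx : 0 < x.2) :
    ((measure d α).prod (sinMeasure α)).map (fun p => a⁻¹ • translationMap x p) =
      ((sinMass α).toNNReal * (a⁻¹ ^ (-(2 * α + d + 2))).toNNReal) • measure d α := by
  have h1 : Measurable (translationMap x) := (continuous_translationMap x).measurable
  have h2 : Measurable fun y : Space d => a⁻¹ • y := measurable_const_smul _
  have h := Measure.map_map (μ := (measure d α).prod (sinMeasure α)) h2 h1
  rw [map_translationMap hα hx, Measure.map_smul, map_smul_measure hα (inv_pos.2 ha), smul_smul]
    at h
  exact h.symm

lemma map_fst_sinMeasure (hα : -1 / 2 < α) :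
    ((measure d α).prod (sinMeasure α)).map Prod.fst =
      (sinMeasure α univ).toNNReal • measure d α := by
  have hfin := isFiniteMeasure_sinMeasure hα
  rw [Measure.map_fst_prod, ENNReal.smul_def, ENNReal.coe_toNNReal (measure_ne_top _ _)]

/-- The pairing of a function with the generalized translate of a dilated function, computed on
the spectral side. -/
lemma integral_mul_conj_translation (hα : -1 / 2 < α) {a : ℝ} (ha : 0 < a) {x : Space d}
    (hx : 0 < x.2) (φ f : L2 d α) :
    ∫ p : Space d × ℝ, f p.1 * conj (φ (a⁻¹ • translationMap x p))
      ∂((measure d α).prod (sinMeasure α)) =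
    ((sinMass α * a ^ (2 * α + d + 2) / gaussConst d α ^ 2 : ℝ) : ℂ) *
      integralTransform α (waveletSymbol (transform φ) (transform f) a) x := by
  have hfin := isFiniteMeasure_sinMeasure hα
  have mV : Measurable fun p => a⁻¹ • translationMap x p :=
    (by fun_prop : Continuous fun p => a⁻¹ • translationMap x p).measurable
  have mD : Measurable fun y : Space d => a • y := measurable_const_smul _
  have hV := map_smul_translationMap hα ha hx
  have hF := map_fst_sinMeasure (d := d) hα
  have hD := map_smul_measure (d := d) hα ha
  -- As bounded operators on L² classes, these compositions make both sides of the formula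
  -- continuous in φ and in f, so it can be extended from Gaussians by density.
  let V := compL2 mV hV
  let L := compL2 measurable_fst hF
  let D := compL2 mD hD
  set c : ℝ := sinMass α * a ^ (2 * α + d + 2) / gaussConst d α ^ 2 with hc
  have hleft : ∀ φ f : L2 d α, ∫ p : Space d × ℝ, f p.1 * conj (φ (a⁻¹ • translationMap x p))
      ∂((measure d α).prod (sinMeasure α)) = inner ℂ (V φ) (L f) := by
    intro φ f
    rw [L2.inner_def]
    refine integral_congr_ae ?_
    filter_upwards [coeFn_compL2 mV hV φ, coeFn_compL2 measurable_fst hF f] with p h1 h2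
    rw [h1, h2, RCLike.inner_apply]
    rfl
  have hk := aestronglyMeasurable_kernel hα x (measure d α)
  have hkc : AEStronglyMeasurable (fun ξ => conj (kernel α ξ x)) (measure d α) :=
    Complex.continuous_conj.comp_aestronglyMeasurable hk
  have mem1 : ∀ f : L2 d α, MemLp (fun ξ => f ξ * kernel α ξ x) 2 (measure d α) := fun f =>
    memLp_mul_of_norm_le_one (Lp.memLp f) hk fun ξ => norm_kernel_le hα ξ x
  have mem2 : ∀ f : L2 d α, MemLp (fun ξ => f ξ * conj (kernel α ξ x)) 2 (measure d α) := fun f =>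
    memLp_mul_of_norm_le_one (Lp.memLp f) hkc fun ξ => by
      rw [RCLike.norm_conj]; exact norm_kernel_le hα ξ x
  have hright1 : ∀ φ f : L2 d α, integralTransform α (waveletSymbol φ f a) x =
      inner ℂ (D φ) ((mem1 f).toLp _) := by
    intro φ f
    rw [L2.inner_def]
    refine integral_congr_ae ?_
    filter_upwards [coeFn_compL2 mD hD φ, (mem1 f).coeFn_toLp] with ξ h1 h2
    rw [h1, h2, RCLike.inner_apply]
    simp only [waveletSymbol, Function.comp]
    ring
  have hright2 : ∀ φ f : L2 d α, integralTransform α (waveletSymbol φ f a) x =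
      inner ℂ ((mem2 (D φ)).toLp _) f := by
    intro φ f
    rw [L2.inner_def]
    refine integral_congr_ae ?_
    filter_upwards [coeFn_compL2 mD hD φ, (mem2 (D φ)).coeFn_toLp] with ξ h1 h2
    rw [h2, h1, RCLike.inner_apply, map_mul, Complex.conj_conj]
    simp only [waveletSymbol, Function.comp]
    ring
  have hgg : ∀ i j, inner ℂ (V (gaussL2 hα i)) (L (gaussL2 hα j)) =
      (c : ℂ) * integralTransform α (waveletSymbol (transform (gaussL2 hα i))
        (transform (gaussL2 hα j)) a) x := by
    intro i j
    have hT : ∀ i, transform (gaussL2 (d := d) hα i) =ᵐ[measure d α]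
        fun ξ => hatCoeff α i * gauss (hatIndex i).1 (hatIndex i).2 ξ := by
      intro i
      rw [transform_gaussL2]
      filter_upwards [Lp.coeFn_smul (hatCoeff α i) (gaussL2 hα (hatIndex i)),
        coeFn_gaussL2 hα (hatIndex i)] with ξ h1 h2
      rw [h1, Pi.smul_apply, h2, smul_eq_mul]
    have e : integralTransform α (waveletSymbol (transform (gaussL2 hα i))
        (transform (gaussL2 hα j)) a) x = integralTransform α (waveletSymbol
        (fun ξ => hatCoeff α i * gauss (hatIndex i).1 (hatIndex i).2 ξ)
        (fun ξ => hatCoeff α j * gauss (hatIndex j).1 (hatIndex j).2 ξ) a) x := by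
      refine integral_congr_ae ?_
      filter_upwards [(quasiMeasurePreserving_of_map_eq mD hD).ae (hT i), hT j] with ξ h1 h2
      simp only [waveletSymbol]
      rw [h1, h2]
    rw [e, ← integral_gauss_translation_eq hα ha, ← hleft]
    refine integral_congr_ae ?_
    filter_upwards [(quasiMeasurePreserving_of_map_eq mV hV).ae (coeFn_gaussL2 hα i),
      (quasiMeasurePreserving_of_map_eq measurable_fst hF).ae (coeFn_gaussL2 hα j)] with p h1 h2
    rw [h1, h2]
  have hdense : Dense (Submodule.span ℂ (range (gaussL2 (d := d) hα)) : Set (L2 d α)) :=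
    Submodule.dense_iff_topologicalClosure_eq_top.2 (dense_span_gaussL2 hα)
  -- Density in φ first, with f a Gaussian. The identity is antilinear in φ, so its conjugate is
  -- compared.
  have step1 : ∀ (φ : L2 d α) j, inner ℂ (V φ) (L (gaussL2 hα j)) =
      (c : ℂ) * integralTransform α (waveletSymbol (transform φ)
        (transform (gaussL2 hα j)) a) x := by
    intro φ j
    have key : (innerSL ℂ (L (gaussL2 hα j))) ∘L V =
        (c : ℂ) • (innerSL ℂ ((mem1 (transform (gaussL2 hα j))).toLp _)) ∘L D ∘L transform := by
      refine ContinuousLinearMap.ext_on hdense ?_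
      rintro _ ⟨i, rfl⟩
      simp only [ContinuousLinearMap.comp_apply, innerSL_apply_apply, smul_apply, smul_eq_mul]
      rw [← inner_conj_symm, hgg, hright1, map_mul, Complex.conj_ofReal, inner_conj_symm]
    have h := congrArg (fun T => T φ) key
    simp only [ContinuousLinearMap.comp_apply, innerSL_apply_apply, smul_apply, smul_eq_mul] at h
    rw [← inner_conj_symm, h, map_mul, Complex.conj_ofReal, inner_conj_symm, hright1]
  rw [hleft]
  -- Density in f, with φ now arbitrary.
  have key : (innerSL ℂ (V φ)) ∘L L =
      (c : ℂ) • (innerSL ℂ ((mem2 (D (transform φ))).toLp _)) ∘L transform := by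
    refine ContinuousLinearMap.ext_on hdense ?_
    rintro _ ⟨j, rfl⟩
    simp only [ContinuousLinearMap.comp_apply, innerSL_apply_apply, smul_apply, smul_eq_mul]
    rw [step1, hright2]
  have h := congrArg (fun T => T f) key
  simp only [ContinuousLinearMap.comp_apply, innerSL_apply_apply, smul_apply, smul_eq_mul] at h
  rw [h, hright2]

/-- The constant in the spectral formula for the wavelet transform. -/
def waveletConst (d : ℕ) (α : ℝ) : ℝ :=
  Real.Gamma (α + 1) / (Real.sqrt Real.pi * Real.Gamma (α + 1 / 2)) * sinMass α /
    gaussConst d α ^ 2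

/-- The wavelet transform as a Weinstein transform. -/
lemma waveletTransform_eq (hα : -1 / 2 < α) {a : ℝ} (ha : 0 < a) {x : Space d}
    (hx : 0 < x.2) (φ f : L2 d α) :
    waveletTransform α φ f (a, x) = ((waveletConst d α * a ^ (α + 1 + (d : ℝ) / 2) : ℝ) : ℂ) *
      integralTransform α (waveletSymbol (transform φ) (transform f) a) x := by
  have hfin := isFiniteMeasure_sinMeasure hα
  have mV : Measurable fun p => a⁻¹ • translationMap x p :=
    (by fun_prop : Continuous fun p => a⁻¹ • translationMap x p).measurable
  have hV := map_smul_translationMap hα ha hx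
  have hF := map_fst_sinMeasure (d := d) hα
  have htr : ∀ y, translation α x (dilation α a φ) y =
      ((Real.Gamma (α + 1) / (Real.sqrt Real.pi * Real.Gamma (α + 1 / 2)) *
        a ^ (-(2 * α + d + 2)) : ℝ) : ℂ) *
        ∫ θ, φ (a⁻¹ • translationMap x (y, θ)) ∂(sinMeasure α) := by
    intro y
    unfold translation dilation
    rw [integral_sinMeasure, ← integral_const_mul, ← integral_const_mul, Complex.ofReal_mul]
    refine integral_congr_ae (ae_of_all _ fun θ => ?_)
    simp only [translationMap, Complex.real_smul]
    ring
  have hint : Integrable (fun p : Space d × ℝ => f p.1 * conj (φ (a⁻¹ • translationMap x p)))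
      ((measure d α).prod (sinMeasure α)) := by
    have h1 := memLp_comp_of_map_eq measurable_fst hF (Lp.memLp f)
    have h2 := memLp_comp_of_map_eq mV hV (Lp.memLp φ)
    exact MemLp.integrable_mul (p := 2) (q := 2) h1 h2.star
  have h := integral_mul_conj_translation hα ha hx φ f
  rw [integral_prod _ hint] at h
  have e : waveletTransform α φ f (a, x) =
      ((a ^ (α + 1 + (d : ℝ) / 2) *
        (Real.Gamma (α + 1) / (Real.sqrt Real.pi * Real.Gamma (α + 1 / 2)) *
        a ^ (-(2 * α + d + 2))) : ℝ) : ℂ) *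
      ∫ y, ∫ θ, f y * conj (φ (a⁻¹ • translationMap x (y, θ))) ∂(sinMeasure α)
        ∂(measure d α) := by
    unfold waveletTransform waveletFamily
    rw [← integral_const_mul]
    congr 1
    ext y
    simp only
    rw [htr, integral_const_mul, integral_conj, map_mul, map_mul, Complex.conj_ofReal,
      Complex.conj_ofReal]
    push_cast
    ring
  rw [e, h, ← mul_assoc, ← Complex.ofReal_mul]
  congr 2
  unfold waveletConst
  rw [Real.rpow_neg ha.le]
  have : a ^ (2 * α + d + 2) ≠ 0 := by positivity
  field_simp

/-! ### Scale measures and square integrability of the wavelet transform. -/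

/-- The measure `da / a` on `(0, ∞)`. -/
def scaleMeasure : Measure ℝ :=
  ((volume : Measure ℝ).restrict (Ioi 0)).withDensity fun a => ENNReal.ofReal a⁻¹

instance : SigmaFinite scaleMeasure := by
  unfold scaleMeasure
  exact SigmaFinite.withDensity_ofReal _

/-- The factor `da / a^{2α+d+3}` of the measure on `𝕏`. -/
def scaleMeasureX (d : ℕ) (α : ℝ) : Measure ℝ :=
  ((volume : Measure ℝ).restrict (Ioi 0)).withDensity fun a =>
    ENNReal.ofReal (a ^ (-(2 * α + d + 3)))

instance : SigmaFinite (scaleMeasureX d α) := by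
  unfold scaleMeasureX
  exact SigmaFinite.withDensity_ofReal _

lemma measureX_eq : measureX d α = (scaleMeasureX d α).prod (measure d α) := rfl

lemma ae_scaleMeasureX_pos : ∀ᵐ a ∂(scaleMeasureX d α), 0 < a :=
  (withDensity_absolutelyContinuous _ _).ae_le (ae_restrict_mem measurableSet_Ioi)

lemma scaleMeasureX_absolutelyContinuous : scaleMeasureX d α ≪ scaleMeasure := by
  refine (withDensity_absolutelyContinuous _ _).trans
    (withDensity_absolutelyContinuous' (by fun_prop) ?_)
  filter_upwards [ae_restrict_mem measurableSet_Ioi] with a ha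
  have ha : 0 < a := ha
  simpa using ha

lemma integral_scaleMeasure (r : ℝ → ℂ) :
    ∫ a, r a ∂scaleMeasure = ∫ a in Ioi (0 : ℝ), r a / (a : ℂ) := by
  unfold scaleMeasure
  rw [integral_withDensity_eq_integral_toReal_smul (by fun_prop) (by simp)]
  refine setIntegral_congr_fun measurableSet_Ioi fun a ha => ?_
  have ha : 0 < a := ha
  rw [ENNReal.toReal_ofReal (by positivity), Complex.real_smul]
  push_cast
  ring

/-- The square of the scale factor in the spectral formula turns the weight of 𝕏 into that of the
dilation-invariant measure da/a, for which the wavelet conditions are stated. -/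
lemma rpow_scale_eq {a : ℝ} (ha : 0 < a) :
    a ^ (-(2 * α + d + 3)) * (a ^ (α + 1 + (d : ℝ) / 2)) ^ 2 = a⁻¹ := by
  rw [← Real.rpow_natCast, ← Real.rpow_mul ha.le, ← Real.rpow_add ha, ← Real.rpow_neg_one]
  congr 1
  push_cast
  ring

lemma integral_scaleMeasureX (r : ℝ → ℂ) :
    ∫ a, ((a ^ (α + 1 + (d : ℝ) / 2) : ℝ) : ℂ) ^ 2 * r a ∂(scaleMeasureX d α) =
      ∫ a, r a ∂scaleMeasure := by
  unfold scaleMeasureX scaleMeasure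
  rw [integral_withDensity_eq_integral_toReal_smul (by fun_prop) (by simp),
    integral_withDensity_eq_integral_toReal_smul (by fun_prop) (by simp)]
  refine setIntegral_congr_fun measurableSet_Ioi fun a ha => ?_
  have ha : 0 < a := ha
  rw [ENNReal.toReal_ofReal (by positivity), ENNReal.toReal_ofReal (by positivity),
    Complex.real_smul, Complex.real_smul, ← rpow_scale_eq (d := d) (α := α) ha]
  push_cast
  ring

lemma lintegral_scaleMeasureX {r : ℝ → ENNReal} (hr : Measurable r) :
    ∫⁻ a, ENNReal.ofReal (a ^ (α + 1 + (d : ℝ) / 2)) ^ 2 * r a ∂(scaleMeasureX d α) =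
      ∫⁻ a, r a ∂scaleMeasure := by
  unfold scaleMeasureX scaleMeasure
  rw [lintegral_withDensity_eq_lintegral_mul _ (by fun_prop) (by fun_prop),
    lintegral_withDensity_eq_lintegral_mul _ (by fun_prop) (by fun_prop)]
  refine setLIntegral_congr_fun measurableSet_Ioi fun a ha => ?_
  have ha : 0 < a := ha
  simp only [Pi.mul_apply]
  rw [← mul_assoc, ← ENNReal.ofReal_pow (by positivity), ← ENNReal.ofReal_mul (by positivity),
    rpow_scale_eq ha]

lemma stronglyMeasurable_waveletSymbol {u v : Space d → ℂ} (hu : StronglyMeasurable u)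
    (hv : StronglyMeasurable v) :
    StronglyMeasurable fun p : ℝ × Space d => waveletSymbol u v p.1 p.2 := by
  unfold waveletSymbol
  have h1 : StronglyMeasurable fun p : ℝ × Space d => u (p.1 • p.2) :=
    hu.comp_measurable (by fun_prop)
  exact (hv.comp_measurable measurable_snd).mul (Complex.continuous_conj.comp_stronglyMeasurable h1)

lemma memLp_comp_smul (hα : -1 / 2 < α) {a : ℝ} (ha : 0 < a) (u : L2 d α) :
    MemLp (fun ξ => u (a • ξ)) 2 (measure d α) :=
  memLp_comp_of_map_eq (measurable_const_smul a) (map_smul_measure hα ha) (Lp.memLp u)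

lemma integrable_waveletSymbol (hα : -1 / 2 < α) {a : ℝ} (ha : 0 < a) (u v : L2 d α) :
    Integrable (waveletSymbol u v a) (measure d α) :=
  MemLp.integrable_mul (p := 2) (q := 2) (Lp.memLp v) (memLp_comp_smul hα ha u).star

/-- The spectral form of the wavelet transform. -/
def spectralWaveletTransform (φ f : L2 d α) (p : ℝ × Space d) : ℂ :=
  ((waveletConst d α * p.1 ^ (α + 1 + (d : ℝ) / 2) : ℝ) : ℂ) *
    integralTransform α (waveletSymbol (transform φ) (transform f) p.1) p.2

lemma waveletTransform_ae_eq (hα : -1 / 2 < α) (φ f : L2 d α) :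
    waveletTransform α φ f =ᵐ[measureX d α] spectralWaveletTransform φ f := by
  rw [measureX_eq]
  have h1 : ∀ᵐ p ∂((scaleMeasureX d α).prod (measure d α)), 0 < p.1 :=
    Measure.quasiMeasurePreserving_fst.ae ae_scaleMeasureX_pos
  have h2 : ∀ᵐ p ∂((scaleMeasureX d α).prod (measure d α)), 0 < p.2.2 :=
    Measure.quasiMeasurePreserving_snd.ae ae_measure_pos
  filter_upwards [h1, h2] with p h1 h2
  exact waveletTransform_eq hα h1 h2 φ f

lemma stronglyMeasurable_spectralWaveletTransform (hα : -1 / 2 < α) (φ f : L2 d α) :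
    StronglyMeasurable (spectralWaveletTransform φ f) := by
  unfold spectralWaveletTransform integralTransform
  refine StronglyMeasurable.mul ?_ ?_
  · refine Measurable.stronglyMeasurable ?_
    fun_prop
  · have h := stronglyMeasurable_waveletSymbol (Lp.stronglyMeasurable (transform φ))
      (Lp.stronglyMeasurable (transform f))
    have h1 : StronglyMeasurable fun q : (ℝ × Space d) × Space d =>
        waveletSymbol (transform φ) (transform f) q.1.1 q.2 :=
      h.comp_measurable (by fun_prop : Measurable fun q : (ℝ × Space d) × Space d => (q.1.1, q.2))
    have h2 : Continuous fun q : (ℝ × Space d) × Space d => kernel α q.2 q.1.2 := by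
      have hJ := continuous_besselJ hα
      unfold kernel
      fun_prop
    exact (h1.mul h2.stronglyMeasurable).integral_prod_right' (ν := measure d α)

/-- Plancherel's identity for the wavelet transform, with both sides possibly infinite. -/
lemma lintegral_spectralWaveletTransform_sq (hα : -1 / 2 < α) (φ f : L2 d α) :
    ∫⁻ p, ‖spectralWaveletTransform φ f p‖ₑ ^ 2 ∂(measureX d α) =
      (‖waveletConst d α‖ₑ * ENNReal.ofReal (gaussConst d α)) ^ 2 *
        ∫⁻ p, ‖waveletSymbol (transform φ) (transform f) p.1 p.2‖ₑ ^ 2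
          ∂(scaleMeasure.prod (measure d α)) := by
  have hm := stronglyMeasurable_spectralWaveletTransform hα φ f
  have hs := stronglyMeasurable_waveletSymbol (Lp.stronglyMeasurable (transform φ))
      (Lp.stronglyMeasurable (transform f))
  have hs2 : Measurable fun p : ℝ × Space d =>
      ‖waveletSymbol (transform φ) (transform f) p.1 p.2‖ₑ ^ 2 := hs.measurable.enorm.pow_const 2
  have hmul : Measurable fun a : ℝ => ENNReal.ofReal (a ^ (α + 1 + (d : ℝ) / 2)) ^ 2 *
      ∫⁻ ξ, ‖waveletSymbol (transform φ) (transform f) a ξ‖ₑ ^ 2 ∂(measure d α) :=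
    (by fun_prop : Measurable fun a : ℝ => ENNReal.ofReal (a ^ (α + 1 + (d : ℝ) / 2)) ^ 2).mul
      hs2.lintegral_prod_right'
  rw [measureX_eq, lintegral_prod _ (hm.measurable.enorm.pow_const 2).aemeasurable,
    lintegral_prod _ hs2.aemeasurable, ← lintegral_scaleMeasureX (d := d) (α := α)
    hs2.lintegral_prod_right', ← lintegral_const_mul _ hmul]
  refine lintegral_congr_ae ?_
  filter_upwards [ae_scaleMeasureX_pos] with a ha
  have hi := integrable_waveletSymbol hα ha (transform φ) (transform f)
  have hc := (continuous_integralTransform hα hi).measurable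
  simp only [spectralWaveletTransform, enorm_mul, mul_pow]
  rw [lintegral_const_mul _ (hc.enorm.pow_const 2), lintegral_integralTransform_sq hα hi]
  have e1 : ‖((waveletConst d α * a ^ (α + 1 + (d : ℝ) / 2) : ℝ) : ℂ)‖ₑ =
      ‖waveletConst d α‖ₑ * ENNReal.ofReal (a ^ (α + 1 + (d : ℝ) / 2)) := by
    rw [← ofReal_norm, Complex.norm_real, ofReal_norm, enorm_mul]
    congr 1
    exact Real.enorm_of_nonneg (by positivity)
  rw [e1]
  ring

lemma waveletConst_pos (hα : -1 / 2 < α) : 0 < waveletConst d α := by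
  unfold waveletConst
  have h1 : 0 < Real.Gamma (α + 1) := Real.Gamma_pos_of_pos (by linarith)
  have h2 : 0 < Real.Gamma (α + 1 / 2) := Real.Gamma_pos_of_pos (by linarith)
  have h3 := sinMass_pos hα
  have h4 := gaussConst_pos (d := d) hα
  have h5 := Real.pi_pos
  positivity

/-- The wavelet transform is square integrable if and only if its spectral symbol is. -/
lemma memLp_waveletTransform_iff (hα : -1 / 2 < α) (φ f : L2 d α) :
    MemLp (waveletTransform α φ f) 2 (measureX d α) ↔
      MemLp (fun p : ℝ × Space d => waveletSymbol (transform φ) (transform f) p.1 p.2) 2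
        (scaleMeasure.prod (measure d α)) := by
  have hs := stronglyMeasurable_waveletSymbol (Lp.stronglyMeasurable (transform φ))
      (Lp.stronglyMeasurable (transform f))
  rw [memLp_congr_ae (waveletTransform_ae_eq hα φ f), memLp_two_iff_lintegral
    (stronglyMeasurable_spectralWaveletTransform hα φ f).aestronglyMeasurable,
    memLp_two_iff_lintegral hs.aestronglyMeasurable, lintegral_spectralWaveletTransform_sq hα]
  have h0 : (‖waveletConst d α‖ₑ * ENNReal.ofReal (gaussConst d α)) ^ 2 ≠ 0 := by
    have h1 := (waveletConst_pos (d := d) hα).ne'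
    have h2 := gaussConst_pos (d := d) hα
    exact pow_ne_zero 2 (mul_ne_zero (by simpa using h1) (by simpa using h2))
  have ht : (‖waveletConst d α‖ₑ * ENNReal.ofReal (gaussConst d α)) ^ 2 ≠ ⊤ :=
    ENNReal.pow_ne_top (ENNReal.mul_ne_top (by simp) (by simp))
  constructor
  · intro h
    exact ENNReal.lt_top_of_mul_ne_top_right h.ne h0
  · intro h
    exact ENNReal.mul_lt_top ht.lt_top h

/-- Integrating the squared symbol in a first, the wavelet condition gives C |F f(ξ)|², and F f is
square integrable. -/
lemma memLp_waveletTransform_of_isWavelet (hα : -1 / 2 < α) {φ : L2 d α} (hφ : IsWavelet φ)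
    (f : L2 d α) : MemLp (waveletTransform α φ f) 2 (measureX d α) := by
  obtain ⟨C, hC, hφ⟩ := hφ
  have hs := stronglyMeasurable_waveletSymbol (Lp.stronglyMeasurable (transform φ))
      (Lp.stronglyMeasurable (transform f))
  rw [memLp_waveletTransform_iff hα, memLp_two_iff_lintegral hs.aestronglyMeasurable,
    lintegral_prod_symm _ (hs.measurable.enorm.pow_const 2).aemeasurable]
  have e : ∀ᵐ ξ ∂(measure d α), ∫⁻ a, ‖waveletSymbol (transform φ) (transform f) a ξ‖ₑ ^ 2
      ∂scaleMeasure = ENNReal.ofReal C * ‖transform f ξ‖ₑ ^ 2 := by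
    filter_upwards [hφ] with ξ hξ
    have hm : Measurable fun a : ℝ => transform φ (a • ξ) :=
      (Lp.stronglyMeasurable (transform φ)).measurable.comp (by fun_prop)
    simp only [waveletSymbol, enorm_mul, mul_pow, RCLike.enorm_conj]
    rw [lintegral_const_mul _ (by fun_prop), mul_comm]
    congr 1
    rw [← hξ.2, ofReal_integral_eq_lintegral_ofReal hξ.1]
    · unfold scaleMeasure
      rw [lintegral_withDensity_eq_lintegral_mul _ (by fun_prop) (by fun_prop)]
      refine setLIntegral_congr_fun measurableSet_Ioi fun a ha => ?_
      have ha : 0 < a := ha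
      simp only [Pi.mul_apply]
      rw [div_eq_inv_mul, ENNReal.ofReal_mul (by positivity), ENNReal.ofReal_pow (norm_nonneg _),
        ofReal_norm]
    · filter_upwards [ae_restrict_mem measurableSet_Ioi] with a ha
      have ha : 0 < a := ha
      simp only [Pi.zero_apply]
      positivity
  rw [lintegral_congr_ae e, lintegral_const_mul' _ _ ENNReal.ofReal_ne_top]
  exact ENNReal.mul_lt_top ENNReal.ofReal_lt_top
    ((memLp_two_iff_lintegral (Lp.aestronglyMeasurable _)).1 (Lp.memLp (transform f)))

/-! ### Parseval at fixed scale and the orthogonality relation. -/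

/-- The Parseval formula for integrable functions in `L²_α`. -/
lemma integral_integralTransform_mul_conj (hα : -1 / 2 < α) {h k : Space d → ℂ}
    (h1 : Integrable h (measure d α)) (h2 : MemLp h 2 (measure d α))
    (k1 : Integrable k (measure d α)) (k2 : MemLp k 2 (measure d α)) :
    ∫ ξ, integralTransform α k ξ * conj (integralTransform α h ξ) ∂(measure d α) =
      (gaussConst d α : ℂ) ^ 2 * ∫ x, k x * conj (h x) ∂(measure d α) := by
  have hP := inner_transform hα (h2.toLp h) (k2.toLp k)
  rw [L2.inner_def, L2.inner_def] at hP
  have e1 : ∫ ξ, integralTransform α k ξ * conj (integralTransform α h ξ) ∂(measure d α) =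
      ∫ ξ, inner ℂ (transform (h2.toLp h) ξ) (transform (k2.toLp k) ξ) ∂(measure d α) := by
    refine integral_congr_ae ?_
    filter_upwards [transform_toLp hα h1 h2, transform_toLp hα k1 k2] with ξ a b
    rw [a, b, RCLike.inner_apply]
  have e2 : ∫ x, k x * conj (h x) ∂(measure d α) =
      ∫ x, inner ℂ (h2.toLp h x) (k2.toLp k x) ∂(measure d α) := by
    refine integral_congr_ae ?_
    filter_upwards [h2.coeFn_toLp, k2.coeFn_toLp] with ξ a b
    rw [a, b, RCLike.inner_apply]
  rw [e1, e2, hP]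

lemma ae_memLp_waveletSymbol {u v : Space d → ℂ} (hu : StronglyMeasurable u)
    (hv : StronglyMeasurable v)
    (h : MemLp (fun p : ℝ × Space d => waveletSymbol u v p.1 p.2) 2
      (scaleMeasure.prod (measure d α))) :
    ∀ᵐ a ∂scaleMeasure, MemLp (waveletSymbol u v a) 2 (measure d α) := by
  have hs := stronglyMeasurable_waveletSymbol hu hv
  have hs2 : Measurable fun p : ℝ × Space d => ‖waveletSymbol u v p.1 p.2‖ₑ ^ 2 :=
    hs.measurable.enorm.pow_const 2
  rw [memLp_two_iff_lintegral hs.aestronglyMeasurable, lintegral_prod _ hs2.aemeasurable] at h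
  filter_upwards [ae_lt_top hs2.lintegral_prod_right' h.ne] with a ha
  have hsa : StronglyMeasurable (waveletSymbol u v a) :=
    hs.comp_measurable (by fun_prop : Measurable fun ξ : Space d => (a, ξ))
  exact (memLp_two_iff_lintegral hsa.aestronglyMeasurable).2 ha

/-- The orthogonality relation for square integrable wavelet transforms. -/
lemma integral_waveletTransform_mul_conj_eq_zero (hα : -1 / 2 < α) {φ ψ : L2 d α}
    (h : IsTwoWaveletWithConstant φ ψ 0) {f g : L2 d α}
    (hf : MemLp (waveletTransform α φ f) 2 (measureX d α))
    (hg : MemLp (waveletTransform α ψ g) 2 (measureX d α)) :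
    ∫ p, waveletTransform α ψ g p * conj (waveletTransform α φ f p) ∂(measureX d α) = 0 := by
  have sf := (memLp_waveletTransform_iff hα φ f).1 hf
  have sg := (memLp_waveletTransform_iff hα ψ g).1 hg
  have hint : Integrable (fun p => waveletTransform α ψ g p * conj (waveletTransform α φ f p))
      (measureX d α) := MemLp.integrable_mul (p := 2) (q := 2) hg hf.star
  have sint : Integrable (fun p : ℝ × Space d =>
      waveletSymbol (transform ψ) (transform g) p.1 p.2 *
        conj (waveletSymbol (transform φ) (transform f) p.1 p.2))
      (scaleMeasure.prod (measure d α)) := MemLp.integrable_mul (p := 2) (q := 2) sg sf.star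
  have hae : (fun p => waveletTransform α ψ g p * conj (waveletTransform α φ f p))
      =ᵐ[measureX d α]
      fun p => spectralWaveletTransform ψ g p * conj (spectralWaveletTransform φ f p) := by
    filter_upwards [waveletTransform_ae_eq hα ψ g, waveletTransform_ae_eq hα φ f] with p h1 h2
    rw [h1, h2]
  have hint' := hint.congr hae
  rw [integral_congr_ae hae]
  rw [measureX_eq] at hint' ⊢
  rw [integral_prod _ hint']
  have e1 : ∀ᵐ a ∂(scaleMeasureX d α), ∫ x, spectralWaveletTransform ψ g (a, x) *
      conj (spectralWaveletTransform φ f (a, x)) ∂(measure d α) =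
      ((a ^ (α + 1 + (d : ℝ) / 2) : ℝ) : ℂ) ^ 2 *
        ((waveletConst d α * gaussConst d α : ℂ) ^ 2 *
        ∫ ξ, waveletSymbol (transform ψ) (transform g) a ξ *
          conj (waveletSymbol (transform φ) (transform f) a ξ) ∂(measure d α)) := by
    -- By Tonelli, the symbols are square integrable in ξ for da/a-almost every a. Absolute
    -- continuity transfers this to the scale measure of 𝕏, so Parseval applies at almost every
    -- scale.
    filter_upwards [ae_scaleMeasureX_pos, scaleMeasureX_absolutelyContinuous.ae_le
      (ae_memLp_waveletSymbol (Lp.stronglyMeasurable _) (Lp.stronglyMeasurable _) sf),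
      scaleMeasureX_absolutelyContinuous.ae_le
      (ae_memLp_waveletSymbol (Lp.stronglyMeasurable _) (Lp.stronglyMeasurable _) sg)]
      with a ha mf mg
    have hP := integral_integralTransform_mul_conj hα
      (integrable_waveletSymbol hα ha (transform φ) (transform f)) mf
      (integrable_waveletSymbol hα ha (transform ψ) (transform g)) mg
    have e : ∀ x, spectralWaveletTransform ψ g (a, x) *
      conj (spectralWaveletTransform φ f (a, x)) =
      (((waveletConst d α * a ^ (α + 1 + (d : ℝ) / 2) : ℝ) : ℂ) ^ 2) *
        (integralTransform α (waveletSymbol (transform ψ) (transform g) a) x *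
        conj (integralTransform α (waveletSymbol (transform φ) (transform f) a) x)) := by
      intro x
      simp only [spectralWaveletTransform, map_mul, Complex.conj_ofReal]
      ring
    simp_rw [e]
    rw [integral_const_mul, hP]
    push_cast
    ring
  rw [integral_congr_ae e1, integral_scaleMeasureX, integral_const_mul]
  have e2 : ∫ a, ∫ ξ, waveletSymbol (transform ψ) (transform g) a ξ *
      conj (waveletSymbol (transform φ) (transform f) a ξ) ∂(measure d α) ∂scaleMeasure = 0 := by
    rw [integral_integral_swap sint]
    refine integral_eq_zero_of_ae ?_
    filter_upwards [h] with ξ hξ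
    -- For fixed ξ, the dependence on a is the conjugate of the two-wavelet integrand, whose
    -- da/a-integral is 0.
    have e3 : ∀ a : ℝ, waveletSymbol (transform ψ) (transform g) a ξ *
        conj (waveletSymbol (transform φ) (transform f) a ξ) =
        transform g ξ * conj (transform f ξ) *
          conj (transform ψ (a • ξ) * conj (transform φ (a • ξ))) := by
      intro a
      simp only [waveletSymbol, map_mul]
      ring
    simp_rw [e3]
    rw [integral_const_mul, integral_conj, integral_scaleMeasure, hξ.2]
    simp
  rw [e2, mul_zero]

end Weinstein

end

/-! ### The theorem. -/

theorem mainTheorem2 (d : ℕ) (α : ℝ) (hα : -1 / 2 < α) (φ ψ : Weinstein.L2 d α)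
    (h : Weinstein.IsTwoWaveletWithConstant φ ψ 0) :
    (∀ F ∈ Weinstein.waveletRange φ, ∀ G ∈ Weinstein.waveletRange ψ, inner ℂ F G = 0) ∧
    (Weinstein.IsWavelet φ → ∀ f : Weinstein.L2 d α,
      MemLp (Weinstein.waveletTransform α φ f) 2 (Weinstein.measureX d α)) ∧
    (Weinstein.IsWavelet ψ → ∀ g : Weinstein.L2 d α,
      MemLp (Weinstein.waveletTransform α ψ g) 2 (Weinstein.measureX d α)) := by
  refine ⟨?_, fun hφ f => Weinstein.memLp_waveletTransform_of_isWavelet hα hφ f,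
    fun hψ g => Weinstein.memLp_waveletTransform_of_isWavelet hα hψ g⟩
  rintro F ⟨f, hF⟩ G ⟨g, hG⟩
  -- Elements of the range are L² classes, which supplies the square integrability needed by the
  -- orthogonality relation.
  have hf := (memLp_congr_ae hF).1 (Lp.memLp F)
  have hg := (memLp_congr_ae hG).1 (Lp.memLp G)
  rw [L2.inner_def, ← Weinstein.integral_waveletTransform_mul_conj_eq_zero hα h hf hg]
  refine integral_congr_ae ?_
  filter_upwards [hF, hG] with p h1 h2
  rw [h1, h2, RCLike.inner_apply]
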